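/- **The recursive frog model.** Let $d\ge 1$, let $\mathbb T_d$ be the infinite rooted $d$-ary tree with root $\varnothing$ (every vertex has exactly $d$ children), and let $p\in[0,1]$. Put $\rho=p/(1-p)$ if $p<1/2$ and $\rho=1$ if $p\ge 1/2$. The recursive frog model $\mathrm{RFM}(d,p)$ is the following process in discrete time. Initially there is one awake frog at $\varnothing$, one sleeping frog at every other vertex, and $\varnothing$ is the only visited site. At each time step one frog is chosen uniformly at random from the (finite) set of awake frogs, and it performs one step, independently of the past given the present configuration: - a frog that has not yet moved away from the root moves to the parent of its position with probability $\rho$, and otherwise to a uniformly chosen child of its position; a frog that has moved away from the root before always moves to a uniformly chosen child of its position; the frog that starts at $\varnothing$ also always moves to a uniformly chosen child, from its first step on; - a frog that reaches $\varnothing$ by a step towards the root is removed; - a frog that moves away from the root onto a site visited before is removed; if the site was not visited before, then it becomes visited and the frog sleeping there wakes up. Let $V$ be the total number of visits to $\varnothing$, that is, the number of steps onto $\varnothing$. $\mathrm{RFM}(d,p)$ is called *recurrent* if $V=\infty$ almost surely. Let $$p'_d=\inf\{p\in[0,1]:\ \mathrm{RFM}(d,p)\text{ is recurrent}\}.$$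 **Proposition.** For the recursive frog model on the binary tree, there is a $p\in[0,1]$ such that $\mathrm{RFM}(2,p)$ is recurrent, and $$p'_2\le 0.4155.$$ -/

import Mathlib

open MeasureTheory ProbabilityTheory

namespace RecursiveFrog

/-- Vertices of the infinite rooted `d`-ary tree, as finite words: the root is the empty word `[]`,
the `i`-th child of `v` is `i :: v`, and the parent of a non-root vertex `v` is `v.tail`. -/
abbrev Vertex (d : ℕ) : Type := List (Fin d)

/-- An awake frog: `home` is the site where it slept initially (this is the name of the frog),
`pos` is its present position, and `descending` records whether it has already
started to move away from the root. -/
structure Frog (d : ℕ) where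
  home : Vertex d
  pos : Vertex d
  descending : Bool
deriving DecidableEq

/-- A configuration of the recursive frog model: the finite set of sites visited so far, the finite
set of awake frogs (those not removed), and the number of visits paid to the root so far.
At every site that is not yet visited there is a sleeping frog. -/
@[ext]
structure State (d : ℕ) where
  visited : Finset (Vertex d)
  awake : Finset (Frog d)
  rootVisits : ℕ

/-- The discrete σ-algebra on configurations. -/
instance (d : ℕ) : MeasurableSpace (State d) := ⊤

/-- At time `0` only the root is visited, and its frog is the only awake one. It leaves the root
by a step to a uniformly chosen child, so it starts out as a descending frog. -/
def initialState (d : ℕ) : State d where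
  visited := {[]}
  awake := {⟨[], [], true⟩}
  rootVisits := 0

/-- The configuration after the frog `f` steps to the parent of its position. If this is the
root, then the visit is counted and the frog is removed. -/
def stepUp {d : ℕ} (s : State d) (f : Frog d) : State d :=
  if f.pos.tail = [] then
    { s with
      awake := s.awake.erase f
      rootVisits := s.rootVisits + 1 }
  else
    { s with
      awake := insert ⟨f.home, f.pos.tail, false⟩ (s.awake.erase f) }

/-- The configuration after the frog `f` steps to the `i`-th child of its position. If that child
was visited before, then the frog is removed. Otherwise the frog sleeping there wakes up,
and `f` will only move away from the root from now on. -/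
def stepDown {d : ℕ} (s : State d) (f : Frog d) (i : Fin d) : State d :=
  let v : Vertex d := i :: f.pos
  if v ∈ s.visited then
    { s with
      awake := s.awake.erase f }
  else
    { s with
      visited := insert v s.visited
      awake := insert ⟨v, v, false⟩ (insert ⟨f.home, v, true⟩ (s.awake.erase f)) }

/-- The probability `ρ` that a frog which has not yet moved away from the root moves towards it:
`p / (1 - p)` if `p < 1 / 2`, and `1` if `1 / 2 ≤ p`. -/
noncomputable def upProb (p : ℝ) : ℝ :=
  if p < 1 / 2 then p / (1 - p) else 1

theorem upProb_nonneg (p : unitInterval) : 0 ≤ upProb p := by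
  unfold upProb
  split_ifs
  · exact div_nonneg p.2.1 (by linarith [p.2.2])
  · exact zero_le_one

theorem upProb_le_one (p : ℝ) : upProb p ≤ 1 := by
  unfold upProb
  split_ifs with h
  · rw [div_le_one (by linarith)]
    linarith
  · exact le_rfl

/-- The coin that shows `true` (a step towards the root) with probability `upProb p`. -/
noncomputable def upCoin (p : unitInterval) : PMF Bool :=
  PMF.ofFintype
    (fun b => cond b (ENNReal.ofReal (upProb p)) (ENNReal.ofReal (1 - upProb p))) (by
      rw [Fintype.sum_bool, cond_true, cond_false,
        ← ENNReal.ofReal_add (upProb_nonneg p) (sub_nonneg.2 (upProb_le_one p))]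
      simp)

/-- The frog `f` steps to a uniformly chosen child of its position. -/
noncomputable def moveDown {d : ℕ} [NeZero d] (s : State d) (f : Frog d) : PMF (State d) :=
  (PMF.uniformOfFintype (Fin d)).map (stepDown s f)

/-- One step of the awake frog `f`. -/
noncomputable def move {d : ℕ} [NeZero d] (p : unitInterval) (s : State d) (f : Frog d) :
    PMF (State d) :=
  if f.descending then moveDown s f
  else (upCoin p).bind fun up => if up then PMF.pure (stepUp s f) else moveDown s f

open Classical in
/-- One step of the recursive frog model: a uniformly chosen awake frog performs one step.
(Without awake frogs nothing happens.) -/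
noncomputable def step {d : ℕ} [NeZero d] (p : unitInterval) (s : State d) : PMF (State d) :=
  if h : s.awake.Nonempty then (PMF.uniformOfFinset s.awake h).bind (move p s)
  else PMF.pure s

/-- The transition of the recursive frog model from time `n` to time `n + 1`, as a kernel on
histories; it depends on the configuration at time `n` only. -/
noncomputable def transition (d : ℕ) [NeZero d] (p : unitInterval) (n : ℕ) :
    Kernel ((i : Finset.Iic n) → (fun _ : ℕ => State d) i) (State d) where
  toFun h := (step p (h ⟨n, Finset.mem_Iic.2 le_rfl⟩)).toMeasure
  measurable' := by
    have h₁ : Measurable fun s : State d => (step p s).toMeasure := measurable_from_top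
    exact h₁.comp (measurable_pi_apply _)

instance (d : ℕ) [NeZero d] (p : unitInterval) (n : ℕ) : IsMarkovKernel (transition d p n) :=
  ⟨fun h => by
    change IsProbabilityMeasure (step p (h ⟨n, Finset.mem_Iic.2 le_rfl⟩)).toMeasure
    infer_instance⟩

/-- The law of the recursive frog model `RFM(d, p)`: the law, on sequences of configurations, of
the Markov chain that starts at `initialState d` and has the transition probabilities `step p`. -/
noncomputable def law (d : ℕ) [NeZero d] (p : unitInterval) : Measure (ℕ → State d) :=
  Kernel.traj (X := fun _ => State d) (transition d p) 0 fun _ => initialState d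

/-- The total number `V` of visits to the root. -/
noncomputable def totalVisits {d : ℕ} (ω : ℕ → State d) : ℕ∞ :=
  ⨆ n, ((ω n).rootVisits : ℕ∞)

/-- `RFM(d, p)` is recurrent if the root is visited infinitely often almost surely. -/
def IsRecurrent (d : ℕ) [NeZero d] (p : unitInterval) : Prop :=
  ∀ᵐ ω ∂(law d p), totalVisits ω = ⊤

/-- The set of all `p ∈ [0, 1]` such that `RFM(d, p)` is recurrent. -/
def recurrentDrifts (d : ℕ) [NeZero d] : Set ℝ :=
  {p | ∃ hp : p ∈ Set.Icc (0 : ℝ) 1, IsRecurrent d ⟨p, hp⟩}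

/-- The critical drift `p'_d` of the recursive frog model on the `d`-ary tree. -/
noncomputable def criticalDrift (d : ℕ) [NeZero d] : ℝ :=
  sInf (recurrentDrifts d)

end RecursiveFrog

open scoped ENNReal

namespace RecursiveFrog

/-- The probability generating function of the number of frogs that leave a freshly entered subtree
of the binary tree upwards, when all frogs are removed `k` generations below its root.
The argument `r` is the probability of a step towards the root. -/
noncomputable def pgf (r : ℝ) : ℕ → ℝ → ℝ
  | 0, _ => 1
  | k + 1, x =>
    (r * x + (1 - r) / 2) * pgf r k (r * x + (1 - r) / 2) * (1 - pgf r k (r * x + (1 - r))) +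
      (r * x + (1 - r)) * pgf r k (r * x + (1 - r)) ^ 2

theorem map_up_mem {r x : ℝ} (hr : r ∈ Set.Icc (0 : ℝ) 1) (hx : x ∈ Set.Icc (0 : ℝ) 1) :
    r * x + (1 - r) ∈ Set.Icc (0 : ℝ) 1 := by
  obtain ⟨h0, h1⟩ := hr
  obtain ⟨x0, x1⟩ := hx
  constructor <;> nlinarith

theorem map_half_mem {r x : ℝ} (hr : r ∈ Set.Icc (0 : ℝ) 1) (hx : x ∈ Set.Icc (0 : ℝ) 1) :
    r * x + (1 - r) / 2 ∈ Set.Icc (0 : ℝ) 1 := by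
  obtain ⟨h0, h1⟩ := hr
  obtain ⟨x0, x1⟩ := hx
  constructor <;> nlinarith

theorem pgf_mem_and_monotoneOn {r : ℝ} (hr : r ∈ Set.Icc (0 : ℝ) 1) (k : ℕ) :
    (∀ x ∈ Set.Icc (0 : ℝ) 1, pgf r k x ∈ Set.Icc (0 : ℝ) 1) ∧
      MonotoneOn (pgf r k) (Set.Icc 0 1) := by
  induction k with
  | zero => exact ⟨fun x _ => by simp [pgf], fun x _ y _ _ => by simp [pgf]⟩
  | succ k ih =>
    obtain ⟨hmem, hmono⟩ := ih
    have hle : ∀ x ∈ Set.Icc (0 : ℝ) 1,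
        pgf r k (r * x + (1 - r) / 2) ≤ pgf r k (r * x + (1 - r)) := fun x hx =>
      hmono (map_half_mem hr hx) (map_up_mem hr hx) (by linarith [hr.2])
    have hab : ∀ x ∈ Set.Icc (0 : ℝ) 1,
        (r * x + (1 - r) / 2) * pgf r k (r * x + (1 - r) / 2) ≤
          (r * x + (1 - r)) * pgf r k (r * x + (1 - r)) := fun x hx =>
      mul_le_mul (by linarith [hr.2]) (hle x hx) (hmem _ (map_half_mem hr hx)).1
        (map_up_mem hr hx).1
    constructor
    · intro x hx
      have hu := map_up_mem hr hx
      have hw := map_half_mem hr hx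
      obtain ⟨g0, g1⟩ := hmem _ hu
      have ha := mul_nonneg hw.1 (hmem _ hw).1
      have hb : (r * x + (1 - r)) * pgf r k (r * x + (1 - r)) ≤ 1 :=
        mul_le_one₀ hu.2 g0 g1
      have := hab x hx
      simp only [pgf]
      constructor
      · exact add_nonneg (mul_nonneg ha (by linarith)) (mul_nonneg hu.1 (sq_nonneg _))
      · nlinarith
    · intro x hx z hz hxz
      have hu := map_up_mem hr hx
      have hw := map_half_mem hr hx
      have hu' := map_up_mem hr hz
      have hw' := map_half_mem hr hz
      have hru : r * x + (1 - r) ≤ r * z + (1 - r) := by nlinarith [hr.1]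
      have hrw : r * x + (1 - r) / 2 ≤ r * z + (1 - r) / 2 := by nlinarith [hr.1]
      have hgu := hmono hu hu' hru
      have ha := mul_le_mul hrw (hmono hw hw' hrw) (hmem _ hw).1 hw'.1
      have hb := mul_le_mul hru hgu (hmem _ hu).1 hu'.1
      have hab' := hab z hz
      obtain ⟨g0, g1⟩ := hmem _ hu
      obtain ⟨g0', g1'⟩ := hmem _ hu'
      simp only [pgf]
      set a := (r * x + (1 - r) / 2) * pgf r k (r * x + (1 - r) / 2)
      set a' := (r * z + (1 - r) / 2) * pgf r k (r * z + (1 - r) / 2)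
      set g := pgf r k (r * x + (1 - r))
      set g' := pgf r k (r * z + (1 - r))
      rw [pow_two, pow_two, ← mul_assoc, ← mul_assoc]
      set b := (r * x + (1 - r)) * g
      set b' := (r * z + (1 - r)) * g'
      nlinarith [mul_nonneg (sub_nonneg.2 ha) (sub_nonneg.2 g1), mul_nonneg (sub_nonneg.2 hb) g0,
        mul_nonneg (sub_nonneg.2 hab') (sub_nonneg.2 hgu)]

theorem pgf_mem {r x : ℝ} (hr : r ∈ Set.Icc (0 : ℝ) 1) (hx : x ∈ Set.Icc (0 : ℝ) 1) (k : ℕ) :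
    pgf r k x ∈ Set.Icc (0 : ℝ) 1 :=
  (pgf_mem_and_monotoneOn hr k).1 x hx

theorem pgf_monotoneOn {r : ℝ} (hr : r ∈ Set.Icc (0 : ℝ) 1) (k : ℕ) :
    MonotoneOn (pgf r k) (Set.Icc 0 1) :=
  (pgf_mem_and_monotoneOn hr k).2

/-- The recursion for `pgf (2 / 3)` improves a geometric bound. -/
theorem geometric_bound_improves {b s : ℝ} (hb : 0 ≤ b) (h0 : 0 ≤ s) (h1 : s ≤ 1 / 3) :
    (5 / 6 - s) * (1 + b * (s + 1 / 6))⁻¹ * (1 - (1 + b * s)⁻¹) + (1 - s) * (1 + b * s)⁻¹ ^ 2 ≤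
      (1 + (b + 1 / 10) * (3 / 2 * s))⁻¹ := by
  have hbs := mul_nonneg hb h0
  have p1 : 0 < 1 + b * (s + 1 / 6) := by nlinarith
  have p2 : 0 < 1 + b * s := by nlinarith
  have p3 : 0 < 1 + (b + 1 / 10) * (3 / 2 * s) := by nlinarith
  have key : ((5 / 6 - s) * (b * s) * (1 + b * s) + (1 - s) * (1 + b * (s + 1 / 6))) *
      (1 + (b + 1 / 10) * (3 / 2 * s)) ≤ (1 + b * (s + 1 / 6)) * (1 + b * s) ^ 2 := by
    have h3 : 0 ≤ 1 / 6 - 1 / 4 * s + 3 / 2 * s ^ 2 := by nlinarith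
    have h2 : 3 / 40 ≤ 1 / 12 - 1 / 3 * s + 31 / 8 * s ^ 2 := by
      nlinarith [sq_nonneg (s - 1 / 23)]
    have h4 : 0 ≤ 17 / 20 - 23 / 120 * b + 3 / 40 * b ^ 2 := by nlinarith [sq_nonneg (b - 1)]
    have e : (1 + b * (s + 1 / 6)) * (1 + b * s) ^ 2 -
        ((5 / 6 - s) * (b * s) * (1 + b * s) + (1 - s) * (1 + b * (s + 1 / 6))) *
          (1 + (b + 1 / 10) * (3 / 2 * s)) =
        s * ((17 / 20 - 23 / 120 * b + 3 / 40 * b ^ 2) +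
          (3 / 20 * s + b * s * (13 / 4 + 3 / 10 * s) + b ^ 2 * (3 / 20 * s ^ 3) +
          b ^ 2 * (1 / 12 - 1 / 3 * s + 31 / 8 * s ^ 2 - 3 / 40) +
          b ^ 2 * (b * s) * (1 / 6 - 1 / 4 * s + 3 / 2 * s ^ 2))) := by ring
    have h5 := sub_nonneg.2 h2
    rw [← sub_nonneg, e]
    positivity
  have e : (5 / 6 - s) * (1 + b * (s + 1 / 6))⁻¹ * (1 - (1 + b * s)⁻¹) +
      (1 - s) * (1 + b * s)⁻¹ ^ 2 =
      ((5 / 6 - s) * (b * s) * (1 + b * s) + (1 - s) * (1 + b * (s + 1 / 6))) /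
        ((1 + b * (s + 1 / 6)) * (1 + b * s) ^ 2) := by
    field_simp
    ring
  rw [e, inv_eq_one_div, div_le_div_iff₀ (by positivity) p3, one_mul]
  exact key

theorem pgf_le_geometric (k : ℕ) {x : ℝ} (hx : x ∈ Set.Icc (1 / 2 : ℝ) 1) :
    pgf (2 / 3) k x ≤ (1 + k / 10 * (1 - x))⁻¹ := by
  have hr : (2 / 3 : ℝ) ∈ Set.Icc (0 : ℝ) 1 := by constructor <;> norm_num
  induction k generalizing x with
  | zero => simp [pgf]
  | succ k ih =>
    obtain ⟨x0, x1⟩ := hx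
    have hx' : x ∈ Set.Icc (0 : ℝ) 1 := ⟨by linarith, x1⟩
    have hu := ih (x := 2 / 3 * x + (1 - 2 / 3)) ⟨by linarith, by linarith⟩
    have hw := ih (x := 2 / 3 * x + (1 - 2 / 3) / 2) ⟨by linarith, by linarith⟩
    have gu := pgf_mem hr (map_up_mem hr hx') k
    have gw := pgf_mem hr (map_half_mem hr hx') k
    have hwu := pgf_monotoneOn hr k (map_half_mem hr hx') (map_up_mem hr hx') (by norm_num)
    have hk : (0 : ℝ) ≤ k / 10 := by positivity
    have key := geometric_bound_improves hk (s := 2 / 3 * (1 - x)) (by linarith) (by linarith)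
    have e1 : 1 - (2 / 3 * x + (1 - 2 / 3)) = 2 / 3 * (1 - x) := by ring
    have e2 : 1 - (2 / 3 * x + (1 - 2 / 3) / 2) = 2 / 3 * (1 - x) + 1 / 6 := by ring
    have e3 : 2 / 3 * x + (1 - 2 / 3) = 1 - 2 / 3 * (1 - x) := by ring
    have e4 : 2 / 3 * x + (1 - 2 / 3) / 2 = 5 / 6 - 2 / 3 * (1 - x) := by ring
    rw [e1] at hu
    rw [e2] at hw
    have e5 : ((k + 1 : ℕ) : ℝ) / 10 * (1 - x) = (k / 10 + 1 / 10) * (3 / 2 * (2 / 3 * (1 - x))) := by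
      push_cast; ring
    rw [e5]
    refine le_trans ?_ key
    simp only [pgf]
    rw [e3, e4] at hwu ⊢
    rw [e3] at hu gu
    rw [e4] at hw gw
    generalize pgf (2 / 3) k (1 - 2 / 3 * (1 - x)) = g at *
    generalize pgf (2 / 3) k (5 / 6 - 2 / 3 * (1 - x)) = g' at *
    have h1 : (1 + k / 10 * (2 / 3 * (1 - x)))⁻¹ ≤ 1 := inv_le_one_of_one_le₀ (by nlinarith)
    generalize (1 + k / 10 * (2 / 3 * (1 - x)))⁻¹ = h at *
    generalize (1 + k / 10 * (2 / 3 * (1 - x) + 1 / 6))⁻¹ = h' at *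
    set s := 2 / 3 * (1 - x) with hs
    have s0 : 0 ≤ s := by rw [hs]; linarith
    have s1 : s ≤ 1 / 3 := by rw [hs]; linarith
    have step₁ : 0 ≤ (h - g) * ((1 - s) * (h + g) - (5 / 6 - s) * g') :=
      mul_nonneg (by linarith) (by nlinarith [gw.1, gu.1])
    have step₂ : 0 ≤ (5 / 6 - s) * ((h' - g') * (1 - h)) :=
      mul_nonneg (by linarith) (mul_nonneg (by linarith) (by linarith))
    nlinarith

end RecursiveFrog

namespace RecursiveFrog

theorem lintegral_toMeasure_pmf {d : ℕ} (μ : PMF (State d)) (F : State d → ℝ≥0∞) :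
    ∫⁻ s, F s ∂μ.toMeasure = ∑' s, μ s * F s := by
  have h : μ.toMeasure = Measure.sum fun s => μ s • Measure.dirac s := by
    ext A hA
    rw [PMF.toMeasure_apply _ hA, Measure.sum_apply _ hA]
    refine tsum_congr fun s => ?_
    rw [Measure.smul_apply, Measure.dirac_apply' _ hA, smul_eq_mul]
    by_cases hs : s ∈ A <;> simp [hs]
  rw [h, lintegral_sum_measure]
  refine tsum_congr fun s => ?_
  rw [lintegral_smul_measure, lintegral_dirac' _ measurable_from_top, smul_eq_mul]

theorem tsum_bind_mul {α β : Type*} (μ : PMF α) (ν : α → PMF β) (F : β → ℝ≥0∞) :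
    ∑' b, μ.bind ν b * F b = ∑' a, μ a * ∑' b, ν a b * F b := by
  simp_rw [PMF.bind_apply, ← ENNReal.tsum_mul_right, ← ENNReal.tsum_mul_left]
  rw [ENNReal.tsum_comm]
  simp_rw [mul_assoc]

theorem tsum_pure_mul {β : Type*} (b : β) (F : β → ℝ≥0∞) :
    ∑' b', PMF.pure b b' * F b' = F b := by
  rw [tsum_eq_single b]
  · simp
  · intro b' hb'
    simp [PMF.pure_apply, hb']

theorem measurable_eval_comp {d : ℕ} (F : State d → ℝ≥0∞) (t : ℕ) :
    Measurable fun ω : ℕ → State d => F (ω t) :=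
  Measurable.comp (g := F) measurable_from_top (measurable_pi_apply t)

instance (d : ℕ) [NeZero d] (p : unitInterval) : IsProbabilityMeasure (law d p) := by
  unfold law; infer_instance

theorem lintegral_law_zero (d : ℕ) [NeZero d] (p : unitInterval) (F : State d → ℝ≥0∞) :
    ∫⁻ ω, F (ω 0) ∂law d p = F (initialState d) := by
  have hm := Kernel.traj_map_frestrictLe_apply (X := fun _ => State d) (κ := transition d p) 0 0
    (fun _ => initialState d)
  rw [Kernel.partialTraj_self, Kernel.id_apply] at hm
  have hF : Measurable fun x : ((i : Finset.Iic 0) → State d) =>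
      F (x ⟨0, Finset.mem_Iic.2 le_rfl⟩) :=
    Measurable.comp (g := F) measurable_from_top (measurable_pi_apply _)
  have h := congrArg (fun μ => ∫⁻ x, F (x ⟨0, Finset.mem_Iic.2 le_rfl⟩) ∂μ) hm
  rw [lintegral_map hF (by fun_prop), lintegral_dirac' _ hF] at h
  exact h

theorem lintegral_law_succ (d : ℕ) [NeZero d] (p : unitInterval) (F : State d → ℝ≥0∞) (t : ℕ) :
    ∫⁻ ω, F (ω (t + 1)) ∂law d p = ∫⁻ ω, (∑' s, step p (ω t) s * F s) ∂law d p := by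
  have hm := Kernel.partialTraj_compProd_eq_map_traj (X := fun _ => State d)
    (κ := transition d p) (Nat.zero_le t) (x₀ := fun _ => initialState d)
  have hm' := Kernel.traj_map_frestrictLe_apply (X := fun _ => State d) (κ := transition d p) 0 t
    (fun _ => initialState d)
  have hF : Measurable fun x : ((i : Finset.Iic t) → State d) × State d => F x.2 :=
    Measurable.comp (g := F) measurable_from_top measurable_snd
  have h := congrArg (fun μ => ∫⁻ x, F x.2 ∂μ) hm
  rw [lintegral_map hF (by fun_prop), Measure.lintegral_compProd hF, ← hm',
    lintegral_map ?_ (by fun_prop)] at h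
  · refine Eq.trans h.symm (lintegral_congr fun ω => ?_)
    rw [← lintegral_toMeasure_pmf]
    rfl
  · exact Measurable.lintegral_kernel_prod_right' hF

/-- If the expectation of `F (t + 1)` after one step is at most `F t`, up to an error `e t`, then
the same holds for the expectations along the process. -/
theorem lintegral_law_succ_add_le (d : ℕ) [NeZero d] (p : unitInterval)
    {F F' e : State d → ℝ≥0∞} (h : ∀ s, (∑' s', step p s s' * F' s') + e s ≤ F s) (t : ℕ) :
    ∫⁻ ω, F' (ω (t + 1)) ∂law d p + ∫⁻ ω, e (ω t) ∂law d p ≤ ∫⁻ ω, F (ω t) ∂law d p := by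
  rw [lintegral_law_succ, ← lintegral_add_right _ (measurable_eval_comp e t)]
  exact lintegral_mono fun ω => h _

end RecursiveFrog

namespace RecursiveFrog

/-- Properties that hold for all configurations that the process can reach. -/
structure Admissible {d : ℕ} (s : State d) : Prop where
  nil_mem : [] ∈ s.visited
  tail_mem : ∀ v ∈ s.visited, v.tail ∈ s.visited
  pos_mem : ∀ f ∈ s.awake, f.pos ∈ s.visited
  home_mem : ∀ f ∈ s.awake, f.home ∈ s.visited
  home_inj : ∀ f ∈ s.awake, ∀ g ∈ s.awake, f.home = g.home → f = g
  ascending : ∀ f ∈ s.awake, f.descending = false → f.pos ≠ [] ∧ f.pos.length ≤ f.home.length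
  leaf : ∀ v ∈ s.visited, (∀ i, i :: v ∉ s.visited) →
    ∃ f ∈ s.awake, f.pos = v ∧ f.descending = true

variable {d : ℕ} {s : State d} {f : Frog d}

theorem Admissible.suffix_mem (hs : Admissible s) {v w : Vertex d} (hw : w ∈ s.visited)
    (h : v <:+ w) : v ∈ s.visited := by
  induction w with
  | nil => rwa [List.suffix_nil.1 h]
  | cons i w ih =>
    rcases List.suffix_cons_iff.1 h with rfl | h
    · exact hw
    · exact ih (hs.tail_mem _ hw) h

theorem Admissible.moved_notMem (hs : Admissible s) (hf : f ∈ s.awake) (w : Vertex d) (b : Bool) :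
    (⟨f.home, w, b⟩ : Frog d) ∉ s.awake.erase f := fun h =>
  (Finset.mem_erase.1 h).1 (hs.home_inj _ (Finset.mem_erase.1 h).2 _ hf rfl)

theorem Admissible.woken_notMem (hs : Admissible s) {v : Vertex d}
    (hv : v ∉ s.visited) :
    (⟨v, v, false⟩ : Frog d) ∉ insert ⟨f.home, v, true⟩ (s.awake.erase f) := fun h => by
  rcases Finset.mem_insert.1 h with h | h
  · simp at h
  · exact hv (hs.home_mem _ (Finset.mem_erase.1 h).2)

section awakeProd

variable {M : Type*} [CommMonoid M] (h : Frog d → M)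

@[to_additive]
theorem prod_awake_stepUp_of_tail_eq_nil (hf : f ∈ s.awake) (ht : f.pos.tail = []) :
    h f * ∏ g ∈ (stepUp s f).awake, h g = ∏ g ∈ s.awake, h g := by
  rw [stepUp, if_pos ht, Finset.mul_prod_erase _ _ hf]

@[to_additive]
theorem prod_awake_stepUp_of_tail_ne_nil (hs : Admissible s) (hf : f ∈ s.awake)
    (ht : f.pos.tail ≠ []) :
    h f * ∏ g ∈ (stepUp s f).awake, h g =
      h ⟨f.home, f.pos.tail, false⟩ * ∏ g ∈ s.awake, h g := by
  rw [stepUp, if_neg ht]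
  dsimp only
  rw [Finset.prod_insert (hs.moved_notMem hf _ _), mul_left_comm, Finset.mul_prod_erase _ _ hf]

@[to_additive]
theorem prod_awake_stepDown_of_mem (hf : f ∈ s.awake) {i : Fin d} (hi : i :: f.pos ∈ s.visited) :
    h f * ∏ g ∈ (stepDown s f i).awake, h g = ∏ g ∈ s.awake, h g := by
  simp only [stepDown, if_pos hi]
  rw [Finset.mul_prod_erase _ _ hf]

@[to_additive]
theorem prod_awake_stepDown_of_notMem (hs : Admissible s) (hf : f ∈ s.awake) {i : Fin d}
    (hi : i :: f.pos ∉ s.visited) :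
    h f * ∏ g ∈ (stepDown s f i).awake, h g =
      h ⟨i :: f.pos, i :: f.pos, false⟩ * h ⟨f.home, i :: f.pos, true⟩ * ∏ g ∈ s.awake, h g := by
  simp only [stepDown, if_neg hi]
  rw [Finset.prod_insert (hs.woken_notMem hi), Finset.prod_insert (hs.moved_notMem hf _ _),
    ← Finset.mul_prod_erase _ _ hf]
  ac_rfl

end awakeProd

@[simp]
theorem stepUp_visited : (stepUp s f).visited = s.visited := by
  unfold stepUp; split_ifs <;> rfl

theorem stepDown_visited (i : Fin d) :
    (stepDown s f i).visited = insert (i :: f.pos) s.visited := by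
  by_cases hi : i :: f.pos ∈ s.visited
  · simp [stepDown, hi]
  · simp [stepDown, hi]

theorem mem_awake_stepUp {g : Frog d} :
    g ∈ (stepUp s f).awake ↔
      (g ≠ f ∧ g ∈ s.awake) ∨ (f.pos.tail ≠ [] ∧ g = ⟨f.home, f.pos.tail, false⟩) := by
  unfold stepUp
  split_ifs with h
  · simp [h]
  · simp [h, or_comm]

theorem mem_awake_stepDown {g : Frog d} (i : Fin d) :
    g ∈ (stepDown s f i).awake ↔
      (g ≠ f ∧ g ∈ s.awake) ∨ (i :: f.pos ∉ s.visited ∧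
        (g = ⟨i :: f.pos, i :: f.pos, false⟩ ∨ g = ⟨f.home, i :: f.pos, true⟩)) := by
  by_cases hi : i :: f.pos ∈ s.visited
  · simp [stepDown, hi]
  · simp [stepDown, hi]
    tauto

theorem admissible_initialState (d : ℕ) : Admissible (initialState d) := by
  constructor <;> simp [initialState]

theorem Admissible.stepUp (hs : Admissible s) (hf : f ∈ s.awake) (hd : f.descending = false) :
    Admissible (stepUp s f) where
  nil_mem := by simpa using hs.nil_mem
  tail_mem := by simpa using hs.tail_mem
  pos_mem g hg := by
    rw [stepUp_visited]
    rcases mem_awake_stepUp.1 hg with ⟨-, hg⟩ | ⟨-, rfl⟩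
    · exact hs.pos_mem g hg
    · exact hs.tail_mem _ (hs.pos_mem f hf)
  home_mem g hg := by
    rw [stepUp_visited]
    rcases mem_awake_stepUp.1 hg with ⟨-, hg⟩ | ⟨-, rfl⟩
    · exact hs.home_mem g hg
    · exact hs.home_mem f hf
  home_inj g hg g' hg' e := by
    rcases mem_awake_stepUp.1 hg with ⟨hn, hg⟩ | ⟨-, rfl⟩ <;>
      rcases mem_awake_stepUp.1 hg' with ⟨hn', hg'⟩ | ⟨-, rfl⟩
    · exact hs.home_inj g hg g' hg' e
    · exact absurd (hs.home_inj g hg f hf e) hn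
    · exact absurd (hs.home_inj g' hg' f hf e.symm) hn'
    · rfl
  ascending g hg hgd := by
    rcases mem_awake_stepUp.1 hg with ⟨-, hg⟩ | ⟨ht, rfl⟩
    · exact hs.ascending g hg hgd
    · refine ⟨ht, ?_⟩
      have := (hs.ascending f hf hd).2
      simp only [List.length_tail]
      omega
  leaf v hv hc := by
    rw [stepUp_visited] at hv hc
    obtain ⟨g, hg, hp, hgd⟩ := hs.leaf v hv hc
    refine ⟨g, mem_awake_stepUp.2 (Or.inl ⟨?_, hg⟩), hp, hgd⟩
    rintro rfl
    simp [hd] at hgd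

theorem Admissible.stepDown (hs : Admissible s) (hf : f ∈ s.awake) (i : Fin d) :
    Admissible (stepDown s f i) where
  nil_mem := by
    rw [stepDown_visited]
    exact Finset.mem_insert_of_mem hs.nil_mem
  tail_mem v hv := by
    rw [stepDown_visited] at hv ⊢
    rcases Finset.mem_insert.1 hv with rfl | hv
    · exact Finset.mem_insert_of_mem (hs.pos_mem f hf)
    · exact Finset.mem_insert_of_mem (hs.tail_mem v hv)
  pos_mem g hg := by
    rw [stepDown_visited]
    rcases (mem_awake_stepDown i).1 hg with ⟨-, hg⟩ | ⟨-, rfl | rfl⟩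
    · exact Finset.mem_insert_of_mem (hs.pos_mem g hg)
    · exact Finset.mem_insert_self _ _
    · exact Finset.mem_insert_self _ _
  home_mem g hg := by
    rw [stepDown_visited]
    rcases (mem_awake_stepDown i).1 hg with ⟨-, hg⟩ | ⟨-, rfl | rfl⟩
    · exact Finset.mem_insert_of_mem (hs.home_mem g hg)
    · exact Finset.mem_insert_self _ _
    · exact Finset.mem_insert_of_mem (hs.home_mem f hf)
  home_inj g hg g' hg' e := by
    have hfh := hs.home_mem f hf
    rcases (mem_awake_stepDown i).1 hg with ⟨hn, hg⟩ | ⟨hi, rfl | rfl⟩ <;>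
      rcases (mem_awake_stepDown i).1 hg' with ⟨hn', hg'⟩ | ⟨hi', rfl | rfl⟩
    · exact hs.home_inj g hg g' hg' e
    · exact absurd ((show g.home = i :: f.pos from e) ▸ hs.home_mem g hg) hi'
    · exact absurd (hs.home_inj g hg f hf e) hn
    · exact absurd ((show i :: f.pos = g'.home from e) ▸ hs.home_mem g' hg') hi
    · rfl
    · exact absurd ((show i :: f.pos = f.home from e) ▸ hfh) hi
    · exact absurd (hs.home_inj g' hg' f hf e.symm) hn'
    · exact absurd ((show f.home = i :: f.pos from e) ▸ hfh) hi
    · rfl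
  ascending g hg hgd := by
    rcases (mem_awake_stepDown i).1 hg with ⟨-, hg⟩ | ⟨-, rfl | rfl⟩
    · exact hs.ascending g hg hgd
    · simp
    · simp at hgd
  leaf v hv hc := by
    rw [stepDown_visited] at hv
    simp only [stepDown_visited, Finset.mem_insert, not_or] at hc
    by_cases hvi : i :: f.pos ∉ s.visited ∧ v = i :: f.pos
    · exact ⟨⟨f.home, i :: f.pos, true⟩, (mem_awake_stepDown i).2 (Or.inr ⟨hvi.1, Or.inr rfl⟩),
        hvi.2.symm, rfl⟩
    · have hv' : v ∈ s.visited := by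
        rcases Finset.mem_insert.1 hv with h | h
        · by_contra hn
          exact hvi ⟨h ▸ hn, h⟩
        · exact h
      obtain ⟨g, hg, hp, hgd⟩ := hs.leaf v hv' fun j => (hc j).2
      refine ⟨g, (mem_awake_stepDown i).2 (Or.inl ⟨?_, hg⟩), hp, hgd⟩
      rintro rfl
      exact (hc i).1 (by rw [hp])

theorem card_awake_stepUp_le (hf : f ∈ s.awake) : (stepUp s f).awake.card ≤ s.awake.card := by
  have := Finset.card_erase_add_one hf
  unfold stepUp
  split_ifs
  · dsimp only; omega
  · exact (Finset.card_insert_le _ _).trans this.le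

theorem card_awake_stepDown_le (hf : f ∈ s.awake) (i : Fin d) :
    (stepDown s f i).awake.card ≤ s.awake.card + 1 := by
  have := Finset.card_erase_add_one hf
  by_cases hi : i :: f.pos ∈ s.visited
  · simp only [stepDown, if_pos hi]; omega
  · simp only [stepDown, if_neg hi]
    refine (Finset.card_insert_le _ _).trans (Nat.succ_le_succ ?_)
    exact (Finset.card_insert_le _ _).trans this.le

end RecursiveFrog

namespace RecursiveFrog

section Suffix

variable {d : ℕ} {v w : Vertex d}

theorem exists_cons_suffix (h : v <:+ w) (hne : w ≠ v) : ∃ i, i :: v <:+ w := by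
  induction w with
  | nil => exact absurd (List.suffix_nil.1 h).symm hne
  | cons j w ih =>
    rcases List.suffix_cons_iff.1 h with rfl | h
    · exact absurd rfl hne
    · by_cases hw : w = v
      · exact ⟨j, by rw [hw]⟩
      · obtain ⟨i, hi⟩ := ih h hw
        exact ⟨i, hi.trans (List.suffix_cons _ _)⟩

theorem cons_suffix_unique {i j : Fin d} (hi : i :: v <:+ w) (hj : j :: v <:+ w) : i = j := by
  have h := (List.suffix_of_suffix_length_le hi hj (by simp)).eq_of_length (by simp)
  simpa using h

theorem not_cons_suffix_self (i : Fin d) (v : Vertex d) : ¬ i :: v <:+ v := fun h => by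
  simpa using h.length_le

end Suffix

variable {s s' : State 2} {f : Frog 2} {r : ℝ} {n k : ℕ} {v : Vertex 2} {x : ℝ}

/-- The weight of a frog at `v`: `e` if it descends, and `c` if it does not and its home has depth
at most `n`. All other frogs have weight one. -/
noncomputable def frogWeight (n : ℕ) (v : Vertex 2) (e c : ℝ) (f : Frog 2) : ℝ :=
  if f.pos = v then (if f.descending then e else if f.home.length ≤ n then c else 1) else 1

theorem frogWeight_of_pos_ne (h : f.pos ≠ v) (n : ℕ) (e c : ℝ) : frogWeight n v e c f = 1 :=
  if_neg h

/-- The product of the weights of the frogs at `v`. -/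
noncomputable def siteWeight (n : ℕ) (s : State 2) (v : Vertex 2) (e c : ℝ) : ℝ :=
  ∏ f ∈ s.awake, frogWeight n v e c f

/-- For a visited vertex `v` at height `k` above the vertices of depth `n + 1`, the conditional
generating function of the number of frogs with home at depth at most `n` that will leave the
subtree at `v` upwards, when frogs with home below depth `n` are ignored until they descend.
The first summand counts the configurations as if both children of `v` were visited; the others
correct for the child that is never entered. -/
noncomputable def pot (r : ℝ) (n : ℕ) : ℕ → State 2 → Vertex 2 → ℝ → ℝ
  | 0, _, _, _ => 1
  | k + 1, s, v, x =>
    siteWeight n s v 1 (r * x + (1 - r)) *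
        ∏ i, (if i :: v ∈ s.visited then pot r n k s (i :: v) (r * x + (1 - r))
          else pgf r k (r * x + (1 - r))) +
      ∑ i, (1 - pgf r k (r * x + (1 - r))) * siteWeight n s v (1 / 2) (r * x + (1 - r) / 2) *
        (if Fin.rev i :: v ∈ s.visited then 0 else
          if i :: v ∈ s.visited then pot r n k s (i :: v) (r * x + (1 - r) / 2)
            else pgf r k (r * x + (1 - r) / 2))

/-- The factor that the subtree at the child `i` of `v` contributes to `pot` at `v`. -/
noncomputable def branch (r : ℝ) (n k : ℕ) (s : State 2) (v : Vertex 2) (i : Fin 2) (z : ℝ) : ℝ :=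
  if i :: v ∈ s.visited then pot r n k s (i :: v) z else pgf r k z

/-- The part of `pot` where only the child `i` of `v` is entered. -/
noncomputable def oneSided (r : ℝ) (n k : ℕ) (s : State 2) (v : Vertex 2) (x : ℝ) (i : Fin 2) : ℝ :=
  (1 - pgf r k (r * x + (1 - r))) * siteWeight n s v (1 / 2) (r * x + (1 - r) / 2) *
    (if Fin.rev i :: v ∈ s.visited then 0 else branch r n k s v i (r * x + (1 - r) / 2))

/-- The part of `pot` where both children of `v` are treated as if they were visited. -/
noncomputable def twoSided (r : ℝ) (n k : ℕ) (s : State 2) (v : Vertex 2) (x : ℝ) : ℝ :=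
  siteWeight n s v 1 (r * x + (1 - r)) * ∏ i, branch r n k s v i (r * x + (1 - r))

theorem pot_succ (r : ℝ) (n k : ℕ) (s : State 2) (v : Vertex 2) (x : ℝ) :
    pot r n (k + 1) s v x = twoSided r n k s v x + ∑ i, oneSided r n k s v x i := rfl

/-! ### Nonnegativity -/

theorem siteWeight_nonneg (n : ℕ) (s : State 2) (v : Vertex 2) {e c : ℝ} (he : 0 ≤ e)
    (hc : 0 ≤ c) : 0 ≤ siteWeight n s v e c :=
  Finset.prod_nonneg fun f _ => by unfold frogWeight; split_ifs <;> first | assumption | norm_num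

theorem pot_nonneg (hr : r ∈ Set.Icc (0 : ℝ) 1) (n k : ℕ) (s : State 2) (v : Vertex 2)
    (hx : x ∈ Set.Icc (0 : ℝ) 1) : 0 ≤ pot r n k s v x := by
  induction k generalizing v x with
  | zero => simp [pot]
  | succ k ih =>
    have hu := map_up_mem hr hx
    have hw := map_half_mem hr hx
    refine add_nonneg (mul_nonneg (siteWeight_nonneg _ _ _ zero_le_one hu.1)
      (Finset.prod_nonneg fun i _ => ?_)) (Finset.sum_nonneg fun i _ => mul_nonneg
        (mul_nonneg (sub_nonneg.2 (pgf_mem hr hu k).2)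
          (siteWeight_nonneg _ _ _ (by norm_num) hw.1)) ?_)
    · split_ifs
      · exact ih _ hu
      · exact (pgf_mem hr hu k).1
    · split_ifs
      · exact le_rfl
      · exact ih _ hw
      · exact (pgf_mem hr hw k).1

theorem branch_nonneg (hr : r ∈ Set.Icc (0 : ℝ) 1) (n k : ℕ) (s : State 2) (v : Vertex 2)
    (i : Fin 2) (hx : x ∈ Set.Icc (0 : ℝ) 1) : 0 ≤ branch r n k s v i x := by
  unfold branch
  split_ifs
  · exact pot_nonneg hr n k s _ hx
  · exact (pgf_mem hr hx k).1

/-! ### Locality -/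

theorem siteWeight_eq_prod_filter (n : ℕ) (s : State 2) (v : Vertex 2) (e c : ℝ) :
    siteWeight n s v e c = ∏ f ∈ s.awake.filter (fun f => f.pos = v),
      (if f.descending then e else if f.home.length ≤ n then c else 1) :=
  (Finset.prod_filter _ _).symm

theorem siteWeight_congr (h : ∀ g : Frog 2, g.pos = v → (g ∈ s.awake ↔ g ∈ s'.awake)) (e c : ℝ) :
    siteWeight n s v e c = siteWeight n s' v e c := by
  rw [siteWeight_eq_prod_filter, siteWeight_eq_prod_filter]
  congr 1
  ext g
  simp only [Finset.mem_filter]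
  exact ⟨fun hg => ⟨(h g hg.2).1 hg.1, hg.2⟩, fun hg => ⟨(h g hg.2).2 hg.1, hg.2⟩⟩

theorem pot_congr (ha : ∀ g : Frog 2, v <:+ g.pos → (g ∈ s.awake ↔ g ∈ s'.awake))
    (hv : ∀ w, v <:+ w → w ≠ v → (w ∈ s.visited ↔ w ∈ s'.visited)) (r : ℝ) (n k : ℕ) (x : ℝ) :
    pot r n k s v x = pot r n k s' v x := by
  induction k generalizing v x with
  | zero => rfl
  | succ k ih =>
    have h1 : ∀ i, (i :: v ∈ s.visited ↔ i :: v ∈ s'.visited) := fun i =>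
      hv _ (List.suffix_cons _ _) (List.cons_ne_self _ _)
    have h2 : ∀ i z, pot r n k s (i :: v) z = pot r n k s' (i :: v) z := fun i z =>
      ih (fun g hg => ha g ((List.suffix_cons _ _).trans hg))
        (fun w hw _ => hv w ((List.suffix_cons _ _).trans hw) (by
          rintro rfl; exact not_cons_suffix_self _ _ hw)) z
    have h3 : ∀ e c, siteWeight n s v e c = siteWeight n s' v e c :=
      siteWeight_congr fun g hg => ha g (hg ▸ List.suffix_refl _)
    simp only [pot, h1, h2, h3]

theorem branch_congr {i : Fin 2}
    (ha : ∀ g : Frog 2, i :: v <:+ g.pos → (g ∈ s.awake ↔ g ∈ s'.awake))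
    (hv : ∀ w, i :: v <:+ w → (w ∈ s.visited ↔ w ∈ s'.visited)) (r : ℝ) (n k : ℕ) (x : ℝ) :
    branch r n k s v i x = branch r n k s' v i x := by
  unfold branch
  rw [pot_congr ha (fun w hw _ => hv w hw), if_congr (hv _ (List.suffix_refl _)) rfl rfl]

/-- A subtree that has just been entered for the first time. -/
theorem pot_eq_pgf {h : Vertex 2}
    (ha : ∀ g : Frog 2, v <:+ g.pos → (g ∈ s.awake ↔ g = ⟨v, v, false⟩ ∨ g = ⟨h, v, true⟩))
    (hv : ∀ w, v <:+ w → w ≠ v → w ∉ s.visited) (hk : v.length + k = n + 1) (r x : ℝ) :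
    pot r n k s v x = pgf r k x := by
  cases k with
  | zero => rfl
  | succ k =>
    have hW : ∀ e c, siteWeight n s v e c = c * e := fun e c => by
      have hfil : s.awake.filter (fun f => f.pos = v) = {⟨v, v, false⟩, ⟨h, v, true⟩} := by
        ext g
        simp only [Finset.mem_filter, Finset.mem_insert, Finset.mem_singleton]
        constructor
        · rintro ⟨hg, hp⟩
          exact (ha g (hp ▸ List.suffix_refl _)).1 hg
        · intro hg
          have hp : g.pos = v := by rcases hg with rfl | rfl <;> rfl
          exact ⟨(ha g (hp ▸ List.suffix_refl _)).2 hg, hp⟩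
      rw [siteWeight_eq_prod_filter, hfil, Finset.prod_pair (by simp)]
      simp [show v.length ≤ n by omega]
    have hn : ∀ i : Fin 2, i :: v ∉ s.visited := fun i =>
      hv _ (List.suffix_cons _ _) (List.cons_ne_self _ _)
    simp only [pot, pgf, hW, hn, if_false, Fin.prod_univ_two, Fin.sum_univ_two]
    ring

/-! ### The effect of a step on the weights -/

theorem siteWeight_stepUp_of_pos_eq (hs : Admissible s) (hf : f ∈ s.awake)
    (hv : v ≠ []) (hp : f.pos = v) (e c : ℝ) :
    frogWeight n v e c f * siteWeight n (stepUp s f) v e c = siteWeight n s v e c := by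
  by_cases ht : f.pos.tail = []
  · exact prod_awake_stepUp_of_tail_eq_nil _ hf ht
  · have hne : f.pos.tail ≠ v := by
      intro h
      have h1 := congrArg List.length (h.trans hp.symm)
      have h2 := List.length_pos_of_ne_nil hv
      rw [List.length_tail, hp] at h1
      omega
    have := prod_awake_stepUp_of_tail_ne_nil (frogWeight n v e c) hs hf ht
    rwa [frogWeight_of_pos_ne (f := ⟨_, f.pos.tail, _⟩) hne, one_mul] at this

theorem siteWeight_stepUp_of_pos_ne (hs : Admissible s) (hf : f ∈ s.awake) (hv : v ≠ [])
    (hp : f.pos ≠ v) (e c : ℝ) :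
    siteWeight n (stepUp s f) v e c =
      (if f.pos.tail = v ∧ f.home.length ≤ n then c else 1) * siteWeight n s v e c := by
  have hw : frogWeight n v e c f = 1 := frogWeight_of_pos_ne hp n e c
  by_cases ht : f.pos.tail = []
  · have := prod_awake_stepUp_of_tail_eq_nil (frogWeight n v e c) hf ht
    rw [hw, one_mul] at this
    rw [if_neg (by rw [ht]; exact fun h => hv h.1.symm), one_mul]
    exact this
  · have := prod_awake_stepUp_of_tail_ne_nil (frogWeight n v e c) hs hf ht
    rw [hw, one_mul] at this
    refine this.trans ?_
    congr 1
    simp only [frogWeight]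
    split_ifs <;> simp_all

theorem siteWeight_stepDown_of_pos_eq (hs : Admissible s) (hf : f ∈ s.awake)
    (hp : f.pos = v) (i : Fin 2) (e c : ℝ) :
    frogWeight n v e c f * siteWeight n (stepDown s f i) v e c = siteWeight n s v e c := by
  by_cases hi : i :: f.pos ∈ s.visited
  · exact prod_awake_stepDown_of_mem _ hf hi
  · have := prod_awake_stepDown_of_notMem (frogWeight n v e c) hs hf hi
    have hne : i :: f.pos ≠ v := hp ▸ List.cons_ne_self _ _
    rwa [frogWeight_of_pos_ne (f := ⟨_, i :: f.pos, false⟩) hne,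
      frogWeight_of_pos_ne (f := ⟨_, i :: f.pos, true⟩) hne, one_mul, one_mul] at this

theorem siteWeight_stepDown_of_pos_ne (hs : Admissible s) (hf : f ∈ s.awake) (hv : v ∈ s.visited)
    (hp : f.pos ≠ v) (i : Fin 2) (e c : ℝ) :
    siteWeight n (stepDown s f i) v e c = siteWeight n s v e c := by
  have hw : frogWeight n v e c f = 1 := frogWeight_of_pos_ne hp n e c
  by_cases hi : i :: f.pos ∈ s.visited
  · have := prod_awake_stepDown_of_mem (frogWeight n v e c) hf hi
    rwa [hw, one_mul] at this
  · have := prod_awake_stepDown_of_notMem (frogWeight n v e c) hs hf hi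
    have hne : i :: f.pos ≠ v := fun h => hi (h ▸ hv)
    rwa [hw, frogWeight_of_pos_ne (f := ⟨_, i :: f.pos, false⟩) hne,
      frogWeight_of_pos_ne (f := ⟨_, i :: f.pos, true⟩) hne, one_mul, one_mul, one_mul] at this

/-! ### The effect of a step on the branches -/

theorem branch_stepUp_self (i : Fin 2) (z : ℝ) :
    branch r n k (stepUp s f) f.pos i z = branch r n k s f.pos i z := by
  refine branch_congr (fun g hg => ?_) (fun w _ => by rw [stepUp_visited]) r n k z
  have h1 : g ≠ f := by rintro rfl; exact not_cons_suffix_self _ _ hg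
  have h2 : g ≠ ⟨f.home, f.pos.tail, false⟩ := by
    rintro rfl
    exact not_cons_suffix_self _ _ (hg.trans (List.tail_suffix _))
  simp [mem_awake_stepUp, h1, h2]

theorem branch_stepDown_self (hs : Admissible s)
    (hk : f.pos.length + (k + 1) = n + 1) (i j : Fin 2) (z : ℝ) :
    branch r n k (stepDown s f j) f.pos i z = branch r n k s f.pos i z := by
  have hne : ∀ g : Frog 2, i :: f.pos <:+ g.pos → g ≠ f := by
    rintro g hg rfl; exact not_cons_suffix_self _ _ hg
  by_cases hj : j :: f.pos ∈ s.visited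
  · refine branch_congr (fun g hg => ?_) (fun w _ => by
      rw [stepDown_visited, Finset.insert_eq_self.2 hj]) r n k z
    simp [mem_awake_stepDown, hne g hg, hj]
  by_cases hij : i = j
  · subst hij
    have hmem : i :: f.pos ∈ (stepDown s f i).visited := by
      rw [stepDown_visited]; exact Finset.mem_insert_self _ _
    rw [branch, branch, if_pos hmem, if_neg hj]
    refine pot_eq_pgf (h := f.home) (fun g hg => ?_) (fun w hw hwne => ?_)
      (by rw [List.length_cons]; omega) r z
    · have : g ∉ s.awake := fun h => hj (hs.suffix_mem (hs.pos_mem g h) hg)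
      simp [mem_awake_stepDown, this, hj]
    · rw [stepDown_visited, Finset.mem_insert, not_or]
      exact ⟨hwne, fun h => hj (hs.suffix_mem h hw)⟩
  · refine branch_congr (fun g hg => ?_) (fun w hw => ?_) r n k z
    · have h1 : ∀ h b, g ≠ ⟨h, j :: f.pos, b⟩ := by
        rintro h b rfl
        exact hij (cons_suffix_unique hg (List.suffix_refl _))
      simp [mem_awake_stepDown, hne g hg, h1]
    · have : w ≠ j :: f.pos := by
        rintro rfl
        exact hij (cons_suffix_unique hw (List.suffix_refl _))
      simp [stepDown_visited, this]

theorem branch_stepUp_of_ne {i j : Fin 2} (hij : j ≠ i) (hf : i :: v <:+ f.pos) (z : ℝ) :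
    branch r n k (stepUp s f) v j z = branch r n k s v j z := by
  refine branch_congr (fun g hg => ?_) (fun w _ => by rw [stepUp_visited]) r n k z
  have h1 : g ≠ f := by rintro rfl; exact hij (cons_suffix_unique hg hf)
  have h2 : g ≠ ⟨f.home, f.pos.tail, false⟩ := by
    rintro rfl
    exact hij (cons_suffix_unique (hg.trans (List.tail_suffix _)) hf)
  simp [mem_awake_stepUp, h1, h2]

theorem branch_stepDown_of_ne {i j : Fin 2} (hij : j ≠ i) (hf : i :: v <:+ f.pos) (l : Fin 2)
    (z : ℝ) : branch r n k (stepDown s f l) v j z = branch r n k s v j z := by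
  have hl : i :: v <:+ l :: f.pos := hf.trans (List.suffix_cons _ _)
  refine branch_congr (fun g hg => ?_) (fun w hw => ?_) r n k z
  · have h1 : g ≠ f := by rintro rfl; exact hij (cons_suffix_unique hg hf)
    have h2 : ∀ h b, g ≠ ⟨h, l :: f.pos, b⟩ := by
      rintro h b rfl
      exact hij (cons_suffix_unique hg hl)
    simp [mem_awake_stepDown, h1, h2]
  · have : w ≠ l :: f.pos := by
      rintro rfl
      exact hij (cons_suffix_unique hw hl)
    simp [stepDown_visited, this]

end RecursiveFrog

namespace RecursiveFrog

variable {s : State 2} {f : Frog 2} {r : ℝ} {n k : ℕ} {v : Vertex 2} {x : ℝ}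

theorem map_up_mem_Ioc (hr : r ∈ Set.Icc (0 : ℝ) 1) (hx : x ∈ Set.Ioc (0 : ℝ) 1) :
    r * x + (1 - r) ∈ Set.Ioc (0 : ℝ) 1 := by
  refine ⟨?_, (map_up_mem hr ⟨hx.1.le, hx.2⟩).2⟩
  rcases hr.1.eq_or_lt with rfl | h
  · norm_num
  · exact add_pos_of_pos_of_nonneg (mul_pos h hx.1) (sub_nonneg.2 hr.2)

theorem map_half_mem_Ioc (hr : r ∈ Set.Icc (0 : ℝ) 1) (hx : x ∈ Set.Ioc (0 : ℝ) 1) :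
    r * x + (1 - r) / 2 ∈ Set.Ioc (0 : ℝ) 1 := by
  refine ⟨?_, (map_half_mem hr ⟨hx.1.le, hx.2⟩).2⟩
  rcases hr.1.eq_or_lt with rfl | h
  · norm_num
  · exact add_pos_of_pos_of_nonneg (mul_pos h hx.1) (by linarith [hr.2])

/-- The mean over the possible moves of `f` of a quantity that is `A` after a step towards the
root and `D i` after a step to the `i`-th child. -/
noncomputable def moveMean (r : ℝ) (f : Frog 2) (A : ℝ) (D : Fin 2 → ℝ) : ℝ :=
  if f.descending then (D 0 + D 1) / 2 else r * A + (1 - r) * ((D 0 + D 1) / 2)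

theorem moveMean_add (r : ℝ) (f : Frog 2) (A A' : ℝ) (D D' : Fin 2 → ℝ) :
    moveMean r f (A + A') (fun i => D i + D' i) = moveMean r f A D + moveMean r f A' D' := by
  unfold moveMean; split_ifs <;> ring

theorem moveMean_mul_left (r : ℝ) (f : Frog 2) (c A : ℝ) (D : Fin 2 → ℝ) :
    moveMean r f (c * A) (fun i => c * D i) = c * moveMean r f A D := by
  unfold moveMean; split_ifs <;> ring

theorem moveMean_mono (hr : r ∈ Set.Icc (0 : ℝ) 1) {A A' : ℝ} {D D' : Fin 2 → ℝ} (hA : A ≤ A')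
    (hD : ∀ i, D i ≤ D' i) : moveMean r f A D ≤ moveMean r f A' D' := by
  have h0 := hD 0
  have h1 := hD 1
  have := mul_le_mul_of_nonneg_left hA hr.1
  have := mul_le_mul_of_nonneg_left (add_le_add h0 h1) (sub_nonneg.2 hr.2)
  unfold moveMean; split_ifs <;> linarith

theorem moveMean_const (r : ℝ) (f : Frog 2) (c : ℝ) : moveMean r f c (fun _ => c) = c := by
  unfold moveMean; split_ifs <;> ring

/-- The factor for a step of `f` out of the subtree at `v`. -/
noncomputable def exitWeight (n : ℕ) (v : Vertex 2) (x : ℝ) (f : Frog 2) : ℝ :=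
  if f.pos = v ∧ f.home.length ≤ n then x else 1

theorem frogWeight_pos {e c : ℝ} (he : 0 < e) (hc : 0 < c) : 0 < frogWeight n v e c f := by
  unfold frogWeight; split_ifs <;> first | assumption | norm_num

theorem moveMean_twoSided_self (hr : r ∈ Set.Icc (0 : ℝ) 1) (hx : x ∈ Set.Ioc (0 : ℝ) 1)
    (hs : Admissible s) (hf : f ∈ s.awake) (hv : f.pos ≠ [])
    (hk : f.pos.length + (k + 1) = n + 1) :
    moveMean r f (exitWeight n f.pos x f * twoSided r n k (stepUp s f) f.pos x)
      (fun i => twoSided r n k (stepDown s f i) f.pos x) ≤ twoSided r n k s f.pos x := by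
  have hu := map_up_mem_Ioc hr hx
  have hc := frogWeight_pos (n := n) (v := f.pos) (f := f) one_pos hu.1
  simp only [twoSided, branch_stepUp_self, branch_stepDown_self hs hk,
    eq_div_of_mul_eq hc.ne' ((mul_comm _ _).trans (siteWeight_stepUp_of_pos_eq (n := n) hs hf hv rfl 1
      (r * x + (1 - r)))),
    eq_div_of_mul_eq hc.ne' ((mul_comm _ _).trans (siteWeight_stepDown_of_pos_eq (n := n) hs hf rfl _ 1
      (r * x + (1 - r))))]
  have hW : 0 ≤ siteWeight n s f.pos 1 (r * x + (1 - r)) / frogWeight n f.pos 1 (r * x + (1 - r)) f :=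
    div_nonneg (siteWeight_nonneg _ _ _ zero_le_one hu.1.le) hc.le
  have hQ : 0 ≤ ∏ i, branch r n k s f.pos i (r * x + (1 - r)) :=
    Finset.prod_nonneg fun i _ => branch_nonneg hr n k s _ i ⟨hu.1.le, hu.2⟩
  have hS : siteWeight n s f.pos 1 (r * x + (1 - r)) =
      siteWeight n s f.pos 1 (r * x + (1 - r)) / frogWeight n f.pos 1 (r * x + (1 - r)) f *
        frogWeight n f.pos 1 (r * x + (1 - r)) f := (div_mul_cancel₀ _ hc.ne').symm
  generalize siteWeight n s f.pos 1 (r * x + (1 - r)) / frogWeight n f.pos 1 (r * x + (1 - r)) f = W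
    at *
  generalize ∏ i, branch r n k s f.pos i (r * x + (1 - r)) = Q at *
  rw [hS]
  have hWQ := mul_nonneg hW hQ
  have key : moveMean r f (exitWeight n f.pos x f) (fun _ => 1) ≤
      frogWeight n f.pos 1 (r * x + (1 - r)) f := by
    simp only [moveMean, exitWeight, frogWeight, true_and, if_true]
    split_ifs <;> linarith
  calc _ = (W * Q) * moveMean r f (exitWeight n f.pos x f) (fun _ => 1) := by
        rw [← moveMean_mul_left]; congr 1 <;> simp [mul_comm]
    _ ≤ (W * Q) * frogWeight n f.pos 1 (r * x + (1 - r)) f := mul_le_mul_of_nonneg_left key hWQ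
    _ = _ := by ring

theorem moveMean_oneSided_self (hr : r ∈ Set.Icc (0 : ℝ) 1) (hx : x ∈ Set.Ioc (0 : ℝ) 1)
    (hs : Admissible s) (hf : f ∈ s.awake) (hv : f.pos ≠ [])
    (hk : f.pos.length + (k + 1) = n + 1) (i : Fin 2) :
    moveMean r f (exitWeight n f.pos x f * oneSided r n k (stepUp s f) f.pos x i)
      (fun j => oneSided r n k (stepDown s f j) f.pos x i) ≤ oneSided r n k s f.pos x i := by
  have hu := map_up_mem_Ioc hr hx
  have hw := map_half_mem_Ioc hr hx
  have hc := frogWeight_pos (n := n) (v := f.pos) (f := f) (one_half_pos (α := ℝ)) hw.1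
  simp only [oneSided, branch_stepUp_self, branch_stepDown_self hs hk, stepUp_visited,
    stepDown_visited,
    eq_div_of_mul_eq hc.ne' ((mul_comm _ _).trans (siteWeight_stepUp_of_pos_eq (n := n) hs hf hv rfl
      (1 / 2) (r * x + (1 - r) / 2))),
    eq_div_of_mul_eq hc.ne' ((mul_comm _ _).trans (siteWeight_stepDown_of_pos_eq (n := n) hs hf rfl _
      (1 / 2) (r * x + (1 - r) / 2)))]
  by_cases hi : Fin.rev i :: f.pos ∈ s.visited
  · simp [hi, moveMean]
  have hW : 0 ≤ siteWeight n s f.pos (1 / 2) (r * x + (1 - r) / 2) /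
      frogWeight n f.pos (1 / 2) (r * x + (1 - r) / 2) f :=
    div_nonneg (siteWeight_nonneg _ _ _ one_half_pos.le hw.1.le) hc.le
  have hQ : 0 ≤ branch r n k s f.pos i (r * x + (1 - r) / 2) :=
    branch_nonneg hr n k s _ i ⟨hw.1.le, hw.2⟩
  have hG : 0 ≤ 1 - pgf r k (r * x + (1 - r)) := sub_nonneg.2 (pgf_mem hr ⟨hu.1.le, hu.2⟩ k).2
  have hS : siteWeight n s f.pos (1 / 2) (r * x + (1 - r) / 2) =
      siteWeight n s f.pos (1 / 2) (r * x + (1 - r) / 2) /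
        frogWeight n f.pos (1 / 2) (r * x + (1 - r) / 2) f *
        frogWeight n f.pos (1 / 2) (r * x + (1 - r) / 2) f := (div_mul_cancel₀ _ hc.ne').symm
  generalize siteWeight n s f.pos (1 / 2) (r * x + (1 - r) / 2) /
      frogWeight n f.pos (1 / 2) (r * x + (1 - r) / 2) f = W at *
  generalize branch r n k s f.pos i (r * x + (1 - r) / 2) = Q at *
  generalize 1 - pgf r k (r * x + (1 - r)) = G at *
  rw [hS]
  have key : moveMean r f (exitWeight n f.pos x f) (fun j => if Fin.rev i = j then 0 else 1) ≤
      frogWeight n f.pos (1 / 2) (r * x + (1 - r) / 2) f := by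
    have h01 : (if Fin.rev i = 0 then (0 : ℝ) else 1) + (if Fin.rev i = 1 then 0 else 1) = 1 := by
      fin_cases i <;> simp [Fin.rev]
    simp only [moveMean, exitWeight, frogWeight, true_and, if_true, h01]
    obtain ⟨r0, r1⟩ := hr
    split_ifs <;> linarith
  calc _ = (G * W * Q) *
        moveMean r f (exitWeight n f.pos x f) (fun j => if Fin.rev i = j then 0 else 1) := by
        rw [← moveMean_mul_left]
        congr 1
        · simp only [hi, if_false]; ring
        · funext j
          by_cases hij : Fin.rev i = j <;> simp [hi, hij]
    _ ≤ (G * W * Q) * frogWeight n f.pos (1 / 2) (r * x + (1 - r) / 2) f :=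
        mul_le_mul_of_nonneg_left key (mul_nonneg (mul_nonneg hG hW) hQ)
    _ = _ := by simp only [hi, if_false]; ring

/-- A step of a frog strictly below `v` changes the weights as seen from the child of `v` above
that frog. -/
theorem siteWeight_stepUp_eq_exitWeight (hs : Admissible s) (hf : f ∈ s.awake) (hv : v ≠ [])
    {i : Fin 2} (hi : i :: v <:+ f.pos) (e c : ℝ) :
    siteWeight n (stepUp s f) v e c = exitWeight n (i :: v) c f * siteWeight n s v e c := by
  have hp : f.pos ≠ v := fun h => not_cons_suffix_self _ _ (h ▸ hi)
  have : f.pos.tail = v ↔ f.pos = i :: v := by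
    constructor
    · intro h
      refine (hi.eq_of_length ?_).symm
      have h1 := hi.length_le
      have h2 := congrArg List.length h
      simp only [List.length_tail, List.length_cons] at h1 h2 ⊢
      omega
    · intro h; rw [h, List.tail_cons]
  rw [siteWeight_stepUp_of_pos_ne hs hf hv hp, exitWeight]
  simp only [this]

theorem moveMean_pot_le (hr : r ∈ Set.Icc (0 : ℝ) 1) (hx : x ∈ Set.Ioc (0 : ℝ) 1)
    (hs : Admissible s) (hf : f ∈ s.awake) (hv : v ≠ []) (hvf : v <:+ f.pos)
    (hk : v.length + k = n + 1) :
    moveMean r f (exitWeight n v x f * pot r n k (stepUp s f) v x)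
      (fun i => pot r n k (stepDown s f i) v x) ≤ pot r n k s v x := by
  induction k generalizing v x with
  | zero =>
    simp only [pot, mul_one]
    refine (moveMean_mono hr (A' := 1) (D' := fun _ => 1) ?_ fun _ => le_rfl).trans
      (moveMean_const r f 1).le
    unfold exitWeight
    split_ifs
    · exact hx.2
    · exact le_rfl
  | succ k ih =>
    by_cases hp : f.pos = v
    · subst hp
      simp only [pot_succ, Fin.sum_univ_two, mul_add]
      rw [moveMean_add, moveMean_add]
      exact add_le_add (moveMean_twoSided_self hr hx hs hf hv hk)
        (add_le_add (moveMean_oneSided_self hr hx hs hf hv hk 0)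
          (moveMean_oneSided_self hr hx hs hf hv hk 1))
    · obtain ⟨i, hi⟩ := exists_cons_suffix hvf hp
      have hu := map_up_mem_Ioc hr hx
      have hw := map_half_mem_Ioc hr hx
      have hvs : v ∈ s.visited := hs.suffix_mem (hs.pos_mem f hf) hvf
      have hivs : i :: v ∈ s.visited := hs.suffix_mem (hs.pos_mem f hf) hi
      have hri : Fin.rev i ≠ i := (by decide : ∀ i : Fin 2, Fin.rev i ≠ i) i
      have hvis : ∀ j l : Fin 2, l :: v ∈ insert (j :: f.pos) s.visited ↔ l :: v ∈ s.visited := by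
        intro j l
        rw [Finset.mem_insert, or_iff_right]
        exact fun h => hp (List.cons.inj h).2.symm
      have ihu := ih hu (List.cons_ne_nil i v) hi (by rw [List.length_cons]; omega)
      have ihw := ih hw (List.cons_ne_nil i v) hi (by rw [List.length_cons]; omega)
      have hex : exitWeight n v x f = 1 := if_neg fun h => hp h.1
      have htwo : moveMean r f (twoSided r n k (stepUp s f) v x)
          (fun j => twoSided r n k (stepDown s f j) v x) ≤ twoSided r n k s v x := by
        have hprod : ∀ F : Fin 2 → ℝ, ∏ l, F l = F (Fin.rev i) * F i := by
          intro F; rw [Fin.prod_univ_two]; clear * -; fin_cases i <;> simp [Fin.rev, mul_comm]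
        simp only [twoSided, hprod, branch_stepUp_of_ne hri hi, branch_stepDown_of_ne hri hi,
          siteWeight_stepUp_eq_exitWeight hs hf hv hi, siteWeight_stepDown_of_pos_ne hs hf hvs hp]
        have hW := siteWeight_nonneg n s v zero_le_one hu.1.le
        have hB := branch_nonneg hr n k s v (Fin.rev i) ⟨hu.1.le, hu.2⟩
        generalize siteWeight n s v 1 (r * x + (1 - r)) = W at *
        generalize branch r n k s v (Fin.rev i) (r * x + (1 - r)) = B at *
        simp only [branch, stepUp_visited, stepDown_visited, hvis, hivs, if_true]
        calc _ = (W * B) * moveMean r f _ _ := by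
              rw [← moveMean_mul_left]
              congr 1
              · ring
              · funext j; ring
          _ ≤ (W * B) * _ := mul_le_mul_of_nonneg_left ihu (mul_nonneg hW hB)
          _ = _ := by ring
      have hone : ∀ l, moveMean r f (oneSided r n k (stepUp s f) v x l)
          (fun j => oneSided r n k (stepDown s f j) v x l) ≤ oneSided r n k s v x l := by
        intro l
        simp only [oneSided, stepUp_visited, stepDown_visited, hvis]
        by_cases hl : Fin.rev l :: v ∈ s.visited
        · simp [hl, moveMean]
        obtain rfl : l = i := by
          by_contra hli
          have : Fin.rev l = i := by exact (by decide : ∀ l i : Fin 2, ¬ l = i → Fin.rev l = i) l i hli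
          exact hl (this ▸ hivs)
        simp only [hl, if_false, branch, stepUp_visited, stepDown_visited, hvis, hivs, if_true,
          siteWeight_stepUp_eq_exitWeight hs hf hv hi, siteWeight_stepDown_of_pos_ne hs hf hvs hp]
        have hW := siteWeight_nonneg n s v one_half_pos.le hw.1.le
        have hG := sub_nonneg.2 (pgf_mem hr ⟨hu.1.le, hu.2⟩ k).2
        generalize siteWeight n s v (1 / 2) (r * x + (1 - r) / 2) = W at *
        generalize 1 - pgf r k (r * x + (1 - r)) = G at *
        calc _ = (G * W) * moveMean r f _ _ := by
              rw [← moveMean_mul_left]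
              congr 1
              ring
          _ ≤ (G * W) * _ := mul_le_mul_of_nonneg_left ihw (mul_nonneg hG hW)
      simp only [hex, one_mul, pot_succ, Fin.sum_univ_two]
      rw [moveMean_add, moveMean_add]
      exact add_le_add htwo (add_le_add (hone 0) (hone 1))

end RecursiveFrog

namespace RecursiveFrog

/-! ### One step of the chain -/

section Step

variable {d : ℕ} [NeZero d]

theorem tsum_moveDown_mul (s : State 2) (f : Frog 2) (F : State 2 → ℝ≥0∞) :
    ∑' s', moveDown s f s' * F s' = (F (stepDown s f 0) + F (stepDown s f 1)) / 2 := by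
  rw [moveDown, PMF.map, tsum_bind_mul]
  simp only [Function.comp_apply, tsum_pure_mul, tsum_fintype, Fin.sum_univ_two,
    PMF.uniformOfFintype_apply, Fintype.card_fin]
  rw [← mul_add, mul_comm, ENNReal.div_eq_inv_mul, mul_comm]
  rfl

theorem tsum_move_mul (p : unitInterval) (s : State 2) (f : Frog 2) (F : State 2 → ℝ≥0∞) :
    ∑' s', move p s f s' * F s' =
      if f.descending then (F (stepDown s f 0) + F (stepDown s f 1)) / 2
      else ENNReal.ofReal (upProb p) * F (stepUp s f) +
        ENNReal.ofReal (1 - upProb p) * ((F (stepDown s f 0) + F (stepDown s f 1)) / 2) := by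
  unfold move
  split_ifs
  · exact tsum_moveDown_mul s f F
  · rw [tsum_bind_mul, tsum_bool]
    simp only [if_true, Bool.false_eq_true, if_false, tsum_pure_mul, tsum_moveDown_mul]
    rw [add_comm]
    rfl

/-- The mean after a move does not exceed a bound that holds for every possible outcome. -/
theorem tsum_move_mul_le (p : unitInterval) {s : State 2} {f : Frog 2} {F : State 2 → ℝ≥0∞}
    {C : ℝ≥0∞} (hup : f.descending = false → F (stepUp s f) ≤ C)
    (hdown : ∀ i, F (stepDown s f i) ≤ C) : ∑' s', move p s f s' * F s' ≤ C := by
  have h : (F (stepDown s f 0) + F (stepDown s f 1)) / 2 ≤ C :=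
    ENNReal.div_le_of_le_mul (by rw [mul_two]; exact add_le_add (hdown 0) (hdown 1))
  rw [tsum_move_mul]
  split_ifs with hd
  · exact h
  · refine (add_le_add (mul_le_mul_right (hup (by simpa using hd)) _)
      (mul_le_mul_right h _)).trans ?_
    rw [← add_mul, ← ENNReal.ofReal_add (upProb_nonneg p) (sub_nonneg.2 (upProb_le_one p))]
    simp

theorem tsum_move_mul_ofReal (p : unitInterval) {s : State 2} {f : Frog 2} {F : State 2 → ℝ≥0∞}
    {A : ℝ} {D : Fin 2 → ℝ} (hA : 0 ≤ A) (hD : ∀ i, 0 ≤ D i)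
    (hup : f.descending = false → F (stepUp s f) = ENNReal.ofReal A)
    (hdown : ∀ i, F (stepDown s f i) = ENNReal.ofReal (D i)) :
    ∑' s', move p s f s' * F s' = ENNReal.ofReal (moveMean (upProb p) f A D) := by
  have h : (F (stepDown s f 0) + F (stepDown s f 1)) / 2 = ENNReal.ofReal ((D 0 + D 1) / 2) := by
    rw [hdown, hdown, ← ENNReal.ofReal_add (hD 0) (hD 1), ENNReal.ofReal_div_of_pos two_pos]
    simp
  have hp := upProb_nonneg p
  have hp' := sub_nonneg.2 (upProb_le_one p)
  have hDD := div_nonneg (add_nonneg (hD 0) (hD 1)) zero_le_two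
  rw [tsum_move_mul, moveMean]
  split_ifs with hd
  · exact h
  · rw [h, hup (by simpa using hd), ← ENNReal.ofReal_mul hp, ← ENNReal.ofReal_mul hp',
      ← ENNReal.ofReal_add (mul_nonneg hp hA) (mul_nonneg hp' hDD)]

theorem tsum_step_mul_add_le (p : unitInterval) {s : State d} (hs : s.awake.Nonempty)
    {F : State d → ℝ≥0∞} {e : Frog d → ℝ≥0∞} {C : ℝ≥0∞}
    (h : ∀ f ∈ s.awake, (∑' s', move p s f s' * F s') + e f ≤ C) :
    (∑' s', step p s s' * F s') + (∑ f ∈ s.awake, e f) / s.awake.card ≤ C := by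
  have hc : (s.awake.card : ℝ≥0∞) ≠ 0 := by simpa using hs.ne_empty
  rw [step, dif_pos hs, tsum_bind_mul, tsum_eq_sum (s := s.awake), ENNReal.div_eq_inv_mul,
    Finset.mul_sum, ← Finset.sum_add_distrib]
  · calc _ ≤ ∑ f ∈ s.awake, (s.awake.card : ℝ≥0∞)⁻¹ * C := by
          refine Finset.sum_le_sum fun f hf => ?_
          rw [PMF.uniformOfFinset_apply_of_mem _ hf, ← mul_add]
          exact mul_le_mul_right (h f hf) _
      _ = C := by
          rw [Finset.sum_const, nsmul_eq_mul, ← mul_assoc,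
            ENNReal.mul_inv_cancel hc (ENNReal.natCast_ne_top _), one_mul]
  · intro f hf
    rw [PMF.uniformOfFinset_apply_of_notMem _ hf, zero_mul]

theorem tsum_step_mul_of_awake_eq_empty (p : unitInterval) {s : State d} (hs : s.awake = ∅)
    (F : State d → ℝ≥0∞) : ∑' s', step p s s' * F s' = F s := by
  rw [step, dif_neg (by simp [hs]), tsum_pure_mul]

end Step

variable {s : State 2} {f : Frog 2} {r : ℝ} {n k : ℕ} {v : Vertex 2} {x : ℝ}

theorem rootVisits_stepUp :
    (stepUp s f).rootVisits = s.rootVisits + if f.pos.tail = [] then 1 else 0 := by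
  unfold stepUp; split_ifs <;> rfl

theorem rootVisits_stepDown (i : Fin 2) : (stepDown s f i).rootVisits = s.rootVisits := by
  by_cases hi : i :: f.pos ∈ s.visited <;> simp [stepDown, hi]

/-! ### The supermartingale -/

/-- The factor that the subtree at the child `i` of the root contributes to `rootPot`. -/
noncomputable def rootBranch (r : ℝ) (n : ℕ) (s : State 2) (x : ℝ) (i : Fin 2) : ℝ :=
  if [i] ∈ s.visited then pot r n n s [i] x else 1

/-- An upper bound for the conditional generating function of the number of visits to the root
by frogs with home at depth at most `n`. -/
noncomputable def rootPot (r : ℝ) (n : ℕ) (s : State 2) (x : ℝ) : ℝ :=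
  x ^ s.rootVisits * (∏ i, rootBranch r n s x i) *
    if ∀ i, [i] ∉ s.visited then pgf r n x else 1

end RecursiveFrog

namespace RecursiveFrog

variable {s : State 2} {f : Frog 2} {r : ℝ} {n k : ℕ} {v : Vertex 2} {x : ℝ}

theorem rootBranch_nonneg (hr : r ∈ Set.Icc (0 : ℝ) 1) (hx : x ∈ Set.Ioc (0 : ℝ) 1) (n : ℕ)
    (s : State 2) (i : Fin 2) : 0 ≤ rootBranch r n s x i := by
  unfold rootBranch
  split_ifs
  · exact pot_nonneg hr n n s _ ⟨hx.1.le, hx.2⟩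
  · exact zero_le_one

theorem rootPot_nonneg (hr : r ∈ Set.Icc (0 : ℝ) 1) (hx : x ∈ Set.Ioc (0 : ℝ) 1) (n : ℕ)
    (s : State 2) : 0 ≤ rootPot r n s x := by
  refine mul_nonneg (mul_nonneg (pow_nonneg hx.1.le _)
    (Finset.prod_nonneg fun i _ => rootBranch_nonneg hr hx n s i)) ?_
  split_ifs
  · exact (pgf_mem hr ⟨hx.1.le, hx.2⟩ n).1
  · exact zero_le_one

theorem rootPot_stepDown_le_of_pos_eq_nil (hr : r ∈ Set.Icc (0 : ℝ) 1)
    (hx : x ∈ Set.Ioc (0 : ℝ) 1) (hs : Admissible s) (hp : f.pos = []) (i : Fin 2) :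
    rootPot r n (stepDown s f i) x ≤ rootPot r n s x := by
  have hx' : x ∈ Set.Icc (0 : ℝ) 1 := ⟨hx.1.le, hx.2⟩
  have hb : ∀ j, branch r n n (stepDown s f i) [] j x = branch r n n s [] j x := fun j => by
    have := branch_stepDown_self (r := r) (f := f) (n := n) (k := n) hs (by simp [hp]) j i x
    rwa [hp] at this
  have hprod : ∀ F : Fin 2 → ℝ, ∏ l, F l = F (Fin.rev i) * F i := by
    intro F; rw [Fin.prod_univ_two]; clear * -; fin_cases i <;> simp [Fin.rev, mul_comm]
  have hb' : ∀ j, [j] ∈ s.visited → rootBranch r n (stepDown s f i) x j = rootBranch r n s x j := by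
    intro j hj
    have hj' : [j] ∈ (stepDown s f i).visited := by
      rw [stepDown_visited]; exact Finset.mem_insert_of_mem hj
    have := hb j
    rw [branch, branch, if_pos hj, if_pos hj'] at this
    rw [rootBranch, rootBranch, if_pos hj, if_pos hj', this]
  have hg := pgf_mem hr hx' n
  by_cases hi : [i] ∈ s.visited
  · have hv : (stepDown s f i).visited = s.visited := by
      rw [stepDown_visited, hp, Finset.insert_eq_self.2 hi]
    have : ∀ j, rootBranch r n (stepDown s f i) x j = rootBranch r n s x j := fun j => by
      by_cases hj : [j] ∈ s.visited
      · exact hb' j hj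
      · rw [rootBranch, rootBranch, hv, if_neg hj, if_neg hj]
    simp only [rootPot, rootVisits_stepDown, hv, this, le_refl]
  · have hmem : [i] ∈ (stepDown s f i).visited := by
      rw [stepDown_visited, hp]; exact Finset.mem_insert_self _ _
    have hself : rootBranch r n (stepDown s f i) x i = pgf r n x := by
      have := hb i
      rw [branch, branch, if_pos hmem, if_neg hi] at this
      rw [rootBranch, if_pos hmem, this]
    have hother : rootBranch r n (stepDown s f i) x (Fin.rev i) =
        rootBranch r n s x (Fin.rev i) := by
      by_cases hj : [Fin.rev i] ∈ s.visited
      · exact hb' _ hj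
      · have hj' : [Fin.rev i] ∉ (stepDown s f i).visited := by
          rw [stepDown_visited, hp, Finset.mem_insert, not_or]
          refine ⟨fun h => ?_, hj⟩
          exact (by decide : ∀ i : Fin 2, Fin.rev i ≠ i) i (List.cons.inj h).1
        rw [rootBranch, rootBranch, if_neg hj, if_neg hj']
    have hle : pgf r n x ≤ if ∀ j, [j] ∉ s.visited then pgf r n x else 1 := by
      split_ifs
      · exact le_rfl
      · exact hg.2
    simp only [rootPot, rootVisits_stepDown, hprod, hself, hother]
    rw [if_neg fun h => h i hmem, mul_one, show rootBranch r n s x i = 1 from if_neg hi, mul_one,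
      ← mul_assoc]
    exact mul_le_mul_of_nonneg_left hle
      (mul_nonneg (pow_nonneg hx.1.le _) (rootBranch_nonneg hr hx n s _))

theorem moveMean_rootPot_le (hr : r ∈ Set.Icc (0 : ℝ) 1) (hx : x ∈ Set.Ioc (0 : ℝ) 1)
    (hs : Admissible s) (hf : f ∈ s.awake) :
    moveMean r f (rootPot r n (stepUp s f) x) (fun i => rootPot r n (stepDown s f i) x) ≤
      rootPot r n s x := by
  by_cases hp : f.pos = []
  · have hd : f.descending = true := by
      by_contra hd
      exact (hs.ascending f hf (by simpa using hd)).1 hp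
    have h := rootPot_stepDown_le_of_pos_eq_nil (n := n) hr hx hs hp
    rw [moveMean, if_pos hd]
    linarith [h 0, h 1]
  obtain ⟨i, hi⟩ := exists_cons_suffix List.nil_suffix hp
  have hiv : [i] ∈ s.visited := hs.suffix_mem (hs.pos_mem f hf) hi
  have hri : Fin.rev i ≠ i := (by decide : ∀ i : Fin 2, Fin.rev i ≠ i) i
  have hvis : ∀ j l : Fin 2, [l] ∈ insert (j :: f.pos) s.visited ↔ [l] ∈ s.visited := by
    intro j l
    rw [Finset.mem_insert, or_iff_right]
    exact fun h => hp (List.cons.inj h).2.symm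
  have hprod : ∀ F : Fin 2 → ℝ, ∏ l, F l = F (Fin.rev i) * F i := by
    intro F; rw [Fin.prod_univ_two]; clear * -; fin_cases i <;> simp [Fin.rev, mul_comm]
  have key := moveMean_pot_le (n := n) (k := n) hr hx hs hf (List.cons_ne_nil i []) hi
    (by simp [add_comm])
  have hup : rootBranch r n (stepUp s f) x (Fin.rev i) = rootBranch r n s x (Fin.rev i) := by
    have := branch_stepUp_of_ne (s := s) (r := r) (n := n) (k := n) hri hi x
    simp only [branch, stepUp_visited] at this
    simp only [rootBranch, stepUp_visited]
    split_ifs at this ⊢ <;> trivial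
  have hdown : ∀ l, rootBranch r n (stepDown s f l) x (Fin.rev i) =
      rootBranch r n s x (Fin.rev i) := fun l => by
    have := branch_stepDown_of_ne (s := s) (r := r) (n := n) (k := n) hri hi l x
    simp only [branch, stepDown_visited, hvis] at this
    simp only [rootBranch, stepDown_visited, hvis]
    split_ifs at this ⊢ <;> trivial
  have hn : ¬ ∀ l, [l] ∉ s.visited := fun h => h i hiv
  have hB := rootBranch_nonneg hr hx n s (Fin.rev i)
  simp only [rootPot, hprod, hup, hdown, rootVisits_stepDown, rootVisits_stepUp, stepUp_visited,
    stepDown_visited, hvis, hn, if_false, mul_one]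
  generalize rootBranch r n s x (Fin.rev i) = B at *
  simp only [rootBranch, stepUp_visited, stepDown_visited, hvis, hiv, if_true]
  have hP := pot_nonneg hr n n (stepUp s f) [i] ⟨hx.1.le, hx.2⟩
  have hX := pow_nonneg hx.1.le s.rootVisits
  have hexit : x ^ (s.rootVisits + if f.pos.tail = [] then 1 else 0) ≤
      x ^ s.rootVisits * exitWeight n [i] x f := by
    rw [pow_add]
    refine mul_le_mul_of_nonneg_left ?_ hX
    unfold exitWeight
    split_ifs with h1 h2 h2
    · simp
    · simpa using hx.2
    · rw [h2.1] at h1; simp at h1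
    · simp
  calc _ ≤ moveMean r f ((x ^ s.rootVisits * B) * (exitWeight n [i] x f * pot r n n (stepUp s f) [i] x))
        (fun l => (x ^ s.rootVisits * B) * pot r n n (stepDown s f l) [i] x) := by
        refine moveMean_mono hr ?_ fun l => by rw [mul_assoc]
        calc _ ≤ x ^ s.rootVisits * exitWeight n [i] x f * (B * pot r n n (stepUp s f) [i] x) :=
              mul_le_mul_of_nonneg_right hexit (mul_nonneg hB hP)
          _ = _ := by ring
    _ = (x ^ s.rootVisits * B) * moveMean r f _ _ := moveMean_mul_left _ _ _ _ _
    _ ≤ (x ^ s.rootVisits * B) * _ := mul_le_mul_of_nonneg_left key (mul_nonneg hX hB)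
    _ = _ := by ring

/-! ### Frogs that are still active -/

/-- A frog is active if it can still change the configuration at depth at most `n` without
climbing up from below. -/
def Active (n : ℕ) (f : Frog 2) : Prop :=
  (f.descending = true ∧ f.pos.length ≤ n) ∨ (f.descending = false ∧ f.home.length ≤ n)

theorem pot_eq_one (hs : Admissible s) (ha : ∀ f ∈ s.awake, ¬ Active n f) (hv : v ∈ s.visited)
    (hk : v.length + k = n + 1) : pot r n k s v x = 1 := by
  induction k generalizing v x with
  | zero => rfl
  | succ k ih =>
    have hvn : v.length ≤ n := by omega
    have hW : ∀ e c, siteWeight n s v e c = 1 := fun e c => by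
      refine Finset.prod_eq_one fun f hf => ?_
      unfold frogWeight
      split_ifs with h1 h2 h3
      · exact absurd (Or.inl ⟨h2, h1 ▸ hvn⟩) (ha f hf)
      · exact absurd (Or.inr ⟨by simpa using h2, h3⟩) (ha f hf)
      · rfl
      · rfl
    have hc : ∀ i, i :: v ∈ s.visited → ∀ z, pot r n k s (i :: v) z = 1 := fun i hi z =>
      ih hi (by rw [List.length_cons]; omega)
    by_cases h0 : 0 :: v ∈ s.visited <;> by_cases h1 : 1 :: v ∈ s.visited
    · simp [pot, Fin.prod_univ_two, Fin.sum_univ_two, h0, h1, hc, hW]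
    · simp [pot, Fin.prod_univ_two, Fin.sum_univ_two, h0, h1, hc, hW]
    · simp [pot, Fin.prod_univ_two, Fin.sum_univ_two, h0, h1, hc, hW]
    · obtain ⟨f, hf, hp, hd⟩ := hs.leaf v hv (Fin.forall_fin_two.2 ⟨h0, h1⟩)
      exact absurd (Or.inl ⟨hd, hp ▸ hvn⟩) (ha f hf)

theorem rootPot_eq_pow (hs : Admissible s) (ha : ∀ f ∈ s.awake, ¬ Active n f) :
    rootPot r n s x = x ^ s.rootVisits := by
  have hn : ¬ ∀ i, [i] ∉ s.visited := fun h => by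
    obtain ⟨f, hf, hp, hd⟩ := hs.leaf [] hs.nil_mem h
    exact ha f hf (Or.inl ⟨hd, by simp [hp]⟩)
  have hb : ∀ i, rootBranch r n s x i = 1 := fun i => by
    unfold rootBranch
    split_ifs with h
    · exact pot_eq_one hs ha h (by simp [add_comm])
    · rfl
  simp [rootPot, hb, hn]

/-- The vertices of depth at most `n`. -/
noncomputable def shallow (n : ℕ) : Finset (Vertex 2) :=
  (List.finite_length_le (Fin 2) n).toFinset

theorem mem_shallow : v ∈ shallow n ↔ v.length ≤ n := by simp [shallow]

/-- A bound for the number of moves that a frog can make while it is active. -/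
def frogEnergy (n : ℕ) (f : Frog 2) : ℕ :=
  if f.descending then n + 1 - f.pos.length
  else if f.home.length ≤ n then n + 2 + f.pos.length else 0

/-- A bound for the number of moves of active frogs that are still to come. -/
noncomputable def energy (n : ℕ) (s : State 2) : ℕ :=
  ∑ f ∈ s.awake, frogEnergy n f + (2 * n + 3) * (shallow n \ s.visited).card

theorem Active.frogEnergy_pos (h : Active n f) : 1 ≤ frogEnergy n f := by
  rcases h with ⟨h1, h2⟩ | ⟨h1, h2⟩
  · simp only [frogEnergy, h1, if_true]; omega
  · simp only [frogEnergy, h1, h2, if_true, Bool.false_eq_true, if_false]; omega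

open Classical in
theorem energy_stepUp_add_le (hs : Admissible s) (hf : f ∈ s.awake) (hd : f.descending = false) :
    energy n (stepUp s f) + (if Active n f then 1 else 0) ≤ energy n s := by
  have hact : (if Active n f then 1 else 0) ≤ frogEnergy n f := by
    split_ifs with h
    · exact h.frogEnergy_pos
    · exact Nat.zero_le _
  unfold energy
  rw [stepUp_visited]
  by_cases ht : f.pos.tail = []
  · have := sum_awake_stepUp_of_tail_eq_nil (frogEnergy n) hf ht
    omega
  · have := sum_awake_stepUp_of_tail_ne_nil (frogEnergy n) hs hf ht
    have h2 : frogEnergy n ⟨f.home, f.pos.tail, false⟩ + (if Active n f then 1 else 0) ≤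
        frogEnergy n f := by
      have hl := List.length_pos_of_ne_nil (hs.ascending f hf hd).1
      by_cases hh : f.home.length ≤ n
      · simp only [frogEnergy, Active, hd, hh, Bool.false_eq_true, if_false, if_true, false_and,
          true_and, false_or, List.length_tail]
        omega
      · simp [frogEnergy, Active, hd, hh]
    omega

open Classical in
theorem energy_stepDown_add_le (hs : Admissible s) (hf : f ∈ s.awake) (i : Fin 2) :
    energy n (stepDown s f i) + (if Active n f then 1 else 0) ≤ energy n s := by
  have hact : (if Active n f then 1 else 0) ≤ frogEnergy n f := by
    split_ifs with h
    · exact h.frogEnergy_pos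
    · exact Nat.zero_le _
  unfold energy
  rw [stepDown_visited]
  by_cases hi : i :: f.pos ∈ s.visited
  · have := sum_awake_stepDown_of_mem (frogEnergy n) hf hi
    rw [Finset.insert_eq_self.2 hi]
    omega
  · have := sum_awake_stepDown_of_notMem (frogEnergy n) hs hf hi
    have hcard : frogEnergy n ⟨i :: f.pos, i :: f.pos, false⟩ +
        frogEnergy n ⟨f.home, i :: f.pos, true⟩ +
        (2 * n + 3) * (shallow n \ insert (i :: f.pos) s.visited).card ≤
        (2 * n + 3) * (shallow n \ s.visited).card := by
      by_cases hl : (i :: f.pos).length ≤ n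
      · have hmem : i :: f.pos ∈ shallow n \ s.visited :=
          Finset.mem_sdiff.2 ⟨mem_shallow.2 hl, hi⟩
        rw [Finset.sdiff_insert, ← Finset.card_erase_add_one hmem, mul_add]
        simp only [frogEnergy, hl, Bool.false_eq_true, if_false, if_true]
        omega
      · have hnm : i :: f.pos ∉ shallow n \ s.visited := fun h =>
          hl (mem_shallow.1 (Finset.mem_sdiff.1 h).1)
        rw [Finset.sdiff_insert, Finset.erase_eq_of_notMem hnm]
        simp only [frogEnergy, hl, Bool.false_eq_true, if_false, if_true]
        omega
    omega

end RecursiveFrog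

namespace RecursiveFrog

variable {s : State 2} {f : Frog 2} {n : ℕ} {x : ℝ}

open Classical in
/-- `rootPot` as a functional of configurations, infinite off the admissible ones. -/
noncomputable def potFunctional (p : unitInterval) (n : ℕ) (x : ℝ) (s : State 2) : ℝ≥0∞ :=
  if Admissible s then ENNReal.ofReal (rootPot (upProb p) n s x) else ⊤

open Classical in
/-- `energy` as a functional of the configurations at time `t`, infinite off those that can be
reached. -/
noncomputable def energyFunctional (n t : ℕ) (s : State 2) : ℝ≥0∞ :=
  if Admissible s ∧ s.awake.card ≤ t + 1 then energy n s else ⊤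

open Classical in
/-- The indicator of the configurations with an active frog. -/
noncomputable def activeIndicator (n : ℕ) (s : State 2) : ℝ≥0∞ :=
  if ∃ f ∈ s.awake, Active n f then 1 else 0

theorem upProb_mem (p : unitInterval) : upProb p ∈ Set.Icc (0 : ℝ) 1 :=
  ⟨upProb_nonneg p, upProb_le_one p⟩

theorem tsum_step_potFunctional_le (p : unitInterval) (hx : x ∈ Set.Ioc (0 : ℝ) 1) (n : ℕ)
    (s : State 2) : ∑' s', step p s s' * potFunctional p n x s' ≤ potFunctional p n x s := by
  by_cases hs : Admissible s
  · by_cases hne : s.awake.Nonempty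
    · refine le_self_add.trans (tsum_step_mul_add_le (e := fun _ => 0) p hne fun f hf => ?_)
      rw [add_zero, tsum_move_mul_ofReal p (rootPot_nonneg (upProb_mem p) hx n (stepUp s f))
        (fun i => rootPot_nonneg (upProb_mem p) hx n (stepDown s f i))
        (fun hd => if_pos (hs.stepUp hf hd)) (fun i => if_pos (hs.stepDown hf i)),
        potFunctional, if_pos hs]
      exact ENNReal.ofReal_le_ofReal (moveMean_rootPot_le (upProb_mem p) hx hs hf)
    · exact (tsum_step_mul_of_awake_eq_empty p (Finset.not_nonempty_iff_eq_empty.1 hne) _).le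
  · rw [potFunctional.eq_def p n x s, if_neg hs]
    exact le_top

theorem tsum_step_energyFunctional_add_le (p : unitInterval) (n t : ℕ) (s : State 2) :
    ∑' s', step p s s' * energyFunctional n (t + 1) s' + activeIndicator n s / (t + 1) ≤
      energyFunctional n t s := by
  classical
  by_cases hs : Admissible s ∧ s.awake.card ≤ t + 1
  · have hE : energyFunctional n t s = energy n s := if_pos hs
    by_cases hne : s.awake.Nonempty
    · refine le_trans (add_le_add le_rfl ?_) (tsum_step_mul_add_le p hne
        (e := fun f => if Active n f then 1 else 0) fun f hf => ?_)
      · by_cases ha : ∃ f ∈ s.awake, Active n f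
        · obtain ⟨f, hf, hfa⟩ := ha
          rw [activeIndicator, if_pos ⟨f, hf, hfa⟩]
          refine ENNReal.div_le_div ?_ (by exact_mod_cast hs.2)
          refine le_trans ?_ (Finset.single_le_sum (fun _ _ => zero_le) hf)
          simp [hfa]
        · rw [activeIndicator, if_neg ha, ENNReal.zero_div]
          exact zero_le
      · rw [hE]
        have key : ∀ s', Admissible s' → s'.awake.card ≤ t + 1 + 1 →
            energy n s' + (if Active n f then 1 else 0) ≤ energy n s →
            energyFunctional n (t + 1) s' ≤
              ((energy n s - (if Active n f then 1 else 0) : ℕ) : ℝ≥0∞) := by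
          intro s' h1 h2 h3
          rw [energyFunctional, if_pos ⟨h1, h2⟩, Nat.cast_le]
          omega
        have hle : (if Active n f then 1 else 0) ≤ energy n s :=
          le_trans (Nat.le_add_left _ _) (energy_stepDown_add_le hs.1 hf 0)
        have hmove := tsum_move_mul_le p (s := s) (f := f)
          (fun hd => key _ (hs.1.stepUp hf hd)
            ((card_awake_stepUp_le hf).trans (hs.2.trans (Nat.le_succ _)))
            (energy_stepUp_add_le hs.1 hf hd))
          (fun i => key _ (hs.1.stepDown hf i)
            ((card_awake_stepDown_le hf i).trans (Nat.succ_le_succ hs.2))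
            (energy_stepDown_add_le hs.1 hf i))
        refine (add_le_add hmove le_rfl).trans (le_of_eq ?_)
        split_ifs at hle ⊢ with h
        · exact_mod_cast Nat.sub_add_cancel hle
        · simp
    · have he := Finset.not_nonempty_iff_eq_empty.1 hne
      rw [tsum_step_mul_of_awake_eq_empty p he, hE, energyFunctional,
        if_pos ⟨hs.1, by simp [he]⟩, activeIndicator, if_neg (by simp [he])]
      simp
  · rw [energyFunctional.eq_def n t s, if_neg hs]
    exact le_top

theorem lintegral_potFunctional_le (p : unitInterval) (hx : x ∈ Set.Ioc (0 : ℝ) 1) (n t : ℕ) :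
    ∫⁻ ω, potFunctional p n x (ω t) ∂law 2 p ≤ ENNReal.ofReal (pgf (upProb p) n x) := by
  induction t with
  | zero =>
    rw [lintegral_law_zero, potFunctional, if_pos (admissible_initialState 2)]
    simp [rootPot, rootBranch, initialState]
  | succ t ih =>
    refine (le_trans ?_ (lintegral_law_succ_add_le 2 p (e := fun _ => 0)
      (fun s => by simpa using tsum_step_potFunctional_le p hx n s) t)).trans ih
    exact le_self_add

theorem sum_lintegral_activeIndicator_le (p : unitInterval) (n T : ℕ) :
    ∑ t ∈ Finset.range T, (∫⁻ ω, activeIndicator n (ω t) ∂law 2 p) / (t + 1) ≤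
      energy n (initialState 2) := by
  have h : ∫⁻ ω, energyFunctional n T (ω T) ∂law 2 p +
      ∑ t ∈ Finset.range T, (∫⁻ ω, activeIndicator n (ω t) ∂law 2 p) / (t + 1) ≤
      energy n (initialState 2) := by
    induction T with
    | zero =>
      rw [lintegral_law_zero, energyFunctional, if_pos ⟨admissible_initialState 2, by
        simp [initialState]⟩]
      simp
    | succ T ih =>
      refine le_trans ?_ ih
      have := lintegral_law_succ_add_le 2 p (tsum_step_energyFunctional_add_le p n T) T
      simp only [div_eq_mul_inv] at this ⊢
      rw [lintegral_mul_const _ (measurable_eval_comp _ T)] at this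
      rw [Finset.sum_range_succ, add_comm (Finset.sum _ _), ← add_assoc]
      exact add_le_add this le_rfl
  exact le_add_self.trans h

/-- The root is visited infinitely often almost surely if the generating functions tend to zero
at some point. -/
theorem isRecurrent_of_tendsto (p : unitInterval) (hx : x ∈ Set.Ioc (0 : ℝ) 1)
    (hlim : Filter.Tendsto (fun n => pgf (upProb p) n x) Filter.atTop (nhds 0)) :
    IsRecurrent 2 p := by
  have hbad : ∀ N : ℕ, law 2 p {ω | ∀ t, (ω t).rootVisits ≤ N} = 0 := by
    intro N
    set B : Set (ℕ → State 2) := {ω | ∀ t, (ω t).rootVisits ≤ N} with hB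
    have hBm : MeasurableSet B := by
      rw [hB, Set.ofPred_forall]
      refine MeasurableSet.iInter fun t => ?_
      exact (measurable_pi_apply (X := fun _ => State 2) t)
        (MeasurableSpace.measurableSet_top (s := {s : State 2 | s.rootVisits ≤ N}))
    set c : ℝ≥0∞ := ENNReal.ofReal (x ^ N) * law 2 p B with hc
    have hc_top : c ≠ ⊤ := ENNReal.mul_ne_top ENNReal.ofReal_ne_top (measure_ne_top _ _)
    have hbound : ∀ n t, c ≤ ENNReal.ofReal (pgf (upProb p) n x) +
        ∫⁻ ω, activeIndicator n (ω t) ∂law 2 p := by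
      intro n t
      refine le_trans ?_ (add_le_add (lintegral_potFunctional_le p hx n t) le_rfl)
      rw [← lintegral_add_right _ (measurable_eval_comp _ t), hc, ← lintegral_indicator_const hBm]
      refine lintegral_mono fun ω => ?_
      by_cases hω : ω ∈ B
      · rw [Set.indicator_of_mem hω]
        by_cases hs : Admissible (ω t)
        · by_cases ha : ∃ f ∈ (ω t).awake, Active n f
          · rw [activeIndicator, if_pos ha]
            refine le_trans ?_ le_add_self
            rw [← ENNReal.ofReal_one]
            exact ENNReal.ofReal_le_ofReal (pow_le_one₀ hx.1.le hx.2)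
          · refine le_trans ?_ le_self_add
            push Not at ha
            rw [potFunctional, if_pos hs, rootPot_eq_pow hs ha]
            exact ENNReal.ofReal_le_ofReal (pow_le_pow_of_le_one hx.1.le hx.2 (hω t))
        · simp [potFunctional, hs]
      · rw [Set.indicator_of_notMem hω]
        exact zero_le
    have hle : ∀ n, c ≤ ENNReal.ofReal (pgf (upProb p) n x) := by
      intro n
      by_contra hlt
      push Not at hlt
      set δ := c - ENNReal.ofReal (pgf (upProb p) n x) with hδ
      have hδ0 : 0 < δ.toReal :=
        ENNReal.toReal_pos (tsub_pos_of_lt hlt).ne' (ENNReal.sub_ne_top hc_top)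
      have hδt : ∀ t, δ ≤ ∫⁻ ω, activeIndicator n (ω t) ∂law 2 p := fun t =>
        tsub_le_iff_left.2 (hbound n t)
      have hsum : ∀ T, δ.toReal * ∑ t ∈ Finset.range T, (1 / ((t : ℝ) + 1)) ≤
          energy n (initialState 2) := by
        intro T
        have h1 : ∑ t ∈ Finset.range T, δ / (t + 1) ≤ (energy n (initialState 2) : ℝ≥0∞) :=
          (Finset.sum_le_sum fun t _ => ENNReal.div_le_div_right (hδt t) _).trans
            (sum_lintegral_activeIndicator_le p n T)
        have h2 := ENNReal.toReal_mono (ENNReal.natCast_ne_top _) h1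
        rw [ENNReal.toReal_sum fun t _ => ENNReal.div_ne_top (ENNReal.sub_ne_top hc_top) (by simp),
          ENNReal.toReal_natCast] at h2
        refine le_trans (le_of_eq ?_) h2
        rw [Finset.mul_sum]
        refine Finset.sum_congr rfl fun t _ => ?_
        rw [ENNReal.toReal_div, ENNReal.toReal_add (ENNReal.natCast_ne_top _) ENNReal.one_ne_top]
        simp [div_eq_mul_inv, hδ]
      have hdiv := Real.tendsto_sum_range_one_div_nat_succ_atTop.const_mul_atTop hδ0
      obtain ⟨T, hT⟩ := (hdiv.eventually_gt_atTop (energy n (initialState 2) : ℝ)).exists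
      exact absurd (hsum T) (not_le.2 hT)
    have hc0 : c ≤ 0 := by
      have := ENNReal.tendsto_ofReal hlim
      rw [ENNReal.ofReal_zero] at this
      exact ge_of_tendsto' this hle
    have := le_zero_iff.1 hc0
    rw [hc, mul_eq_zero] at this
    refine this.resolve_left ?_
    simpa using pow_pos hx.1 N
  refine measure_mono_null (fun ω hω => ?_) (measure_iUnion_null hbad)
  obtain ⟨N, hN⟩ := ENat.ne_top_iff_exists.1 hω
  refine Set.mem_iUnion.2 ⟨N, fun t => ?_⟩
  have : ((ω t).rootVisits : ℕ∞) ≤ N := hN ▸ le_iSup (fun t => ((ω t).rootVisits : ℕ∞)) t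
  exact_mod_cast this

theorem tendsto_pgf_two_thirds :
    Filter.Tendsto (fun n => pgf (2 / 3) n (1 / 2)) Filter.atTop (nhds 0) := by
  have hr : (2 / 3 : ℝ) ∈ Set.Icc (0 : ℝ) 1 := by constructor <;> norm_num
  have hlim : Filter.Tendsto (fun n : ℕ => (1 + (n : ℝ) / 10 * (1 - 1 / 2))⁻¹) Filter.atTop
      (nhds 0) := by
    refine tendsto_inv_atTop_zero.comp (Filter.tendsto_atTop_add_const_left _ _ ?_)
    exact (tendsto_natCast_atTop_atTop.atTop_div_const (by norm_num)).atTop_mul_const (by norm_num)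
  exact squeeze_zero (fun n => (pgf_mem hr ⟨by norm_num, by norm_num⟩ n).1)
    (fun n => pgf_le_geometric n ⟨le_rfl, by norm_num⟩) hlim

theorem two_fifths_mem_recurrentDrifts : (2 / 5 : ℝ) ∈ recurrentDrifts 2 := by
  refine ⟨⟨by norm_num, by norm_num⟩, isRecurrent_of_tendsto (x := 1 / 2) _
    ⟨by norm_num, by norm_num⟩ ?_⟩
  have h : upProb (2 / 5) = 2 / 3 := by norm_num [upProb]
  change Filter.Tendsto (fun n => pgf (upProb (2 / 5)) n (1 / 2)) _ _
  rw [h]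
  exact tendsto_pgf_two_thirds

end RecursiveFrog

theorem mainTheorem2 :
    (RecursiveFrog.recurrentDrifts 2).Nonempty ∧ RecursiveFrog.criticalDrift 2 ≤ 0.4155 :=
  ⟨⟨_, RecursiveFrog.two_fifths_mem_recurrentDrifts⟩,
    (csInf_le ⟨0, fun _ hp => hp.1.1⟩ RecursiveFrog.two_fifths_mem_recurrentDrifts).trans
      (by norm_num)⟩
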